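/- **Setting.** Let $n\in\mathbb N$, let $f_0\in\mathbb R^n$ be the (unknown) vector of values of a function at $n$ fixed design points, and observe $Y=f_0+W$, where $W$ is a random vector of $\mathbb R^n$ that is centered sub-Gaussian with parameter $\sigma^2>0$: $\mathbb E W=0$ and $\mathbb E\exp(\alpha^\top W)\le\exp\left(\tfrac{\sigma^2}{2}\|\alpha\|_2^2\right)$ for all $\alpha\in\mathbb R^n$. Let $\mathcal T$ be a measurable space and $(P_t)_{t\in\mathcal T}$ a measurable family of symmetric positive semi-definite real $n\times n$ matrices with operator norms $\|P_t\|_2\le V$ for all $t$, where $V>0$. Put $\hat f_t=\hat f_t(Y)=P_tY$ and $$r_t=\|Y-\hat f_t\|_2^2+2\sigma^2\operatorname{tr}(P_t)-n\sigma^2 ,$$ and let $\widetilde{\|f_0\|_\infty}$ be the smallest $C\ge 0$ such that $\|P_tf_0\|_2^2\le C^2\operatorname{tr}(P_t^2)$ for all $t\in\mathcal T$; its square is written $\widetilde{\|f_0\|_\infty^2}$. Let $\pi$ be a probability measure on $\mathcal T$, $\beta>4\sigma^2V$, and $\operatorname{pen}:\mathcal T\to\mathbb R$ measurable. Let $f_{EWA}=\int\hat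 f_t\,d\rho(t)$ with $$d\rho(t)=\frac{\exp\left(-\frac1\beta[r_t+\operatorname{pen}(t)]\right)}{\int\exp\left(-\frac1\beta[r_{t'}+\operatorname{pen}(t')]\right)d\pi(t')}\,d\pi(t).$$ Let $\delta\in[0,1]$ be such that $\beta\ge4\sigma^2V(1+4\delta)$, and let $$\gamma=\frac{\beta-4\sigma^2V(1+2\delta)-\sqrt{\beta-4\sigma^2V}\,\sqrt{\beta-4\sigma^2V(1+4\delta)}}{16\sigma^2\delta V^2}\ \text{ if }\delta>0,\qquad \gamma=0\ \text{ if }\delta=0 .$$ For $\nu\in N=\{\nu>0:(1+\nu)\gamma<1\}$ let $$\epsilon'(\nu)=\frac1{1-(1+\nu)\gamma}-1,\qquad \epsilon(\nu)=\frac{(1+\nu)^2\gamma}{\nu(1-(1+\nu)\gamma)},$$ and let $$\operatorname{price}(t)=2\sigma^2\left(\operatorname{tr}(P_t)+\frac{2\sigma^2(1-\delta)(1+2\gamma V)^2}{\beta-4\sigma^2V}\,\frac{\widetilde{\|f_0\|_\infty^2}}{\sigma^2}\operatorname{tr}(P_t^2)\right).$$ **Theorem.** Assume that for every $t\in\mathcal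 T$ $$\operatorname{pen}(t)\ge\frac{4\sigma^2}{\beta-4\sigma^2V}\left(1+(1-\delta)(1+2\gamma V)^2\frac{\widetilde{\|f_0\|_\infty^2}}{\sigma^2}\right)\operatorname{tr}(P_t^2)\,\sigma^2 .$$ Then $\rho$ is a probability measure for every value of $Y$, $f_{EWA}$ is a well-defined (convergent) integral and a measurable function of the randomness, and, with $\mu$ ranging over all probability measures on $\mathcal T$ (an infimum over the empty set being $+\infty$, and $KL(\mu,\pi)\in[0,+\infty]$ denoting the Kullback–Leibler divergence): 1. for every $\eta\in(0,1]$, with probability at least $1-\eta$, $$\|f_0-f_{EWA}\|_2^2\le\inf_{\nu\in N}\inf_{\mu}\Big\{(1+\epsilon(\nu))\int\|f_0-\hat f_t\|_2^2\,d\mu(t)+(1+\epsilon'(\nu))\int(\operatorname{pen}(t)+\operatorname{price}(t))\,d\mu(t)+\beta(1+\epsilon'(\nu))\Big(2KL(\mu,\pi)+\ln\frac1\eta\Big)\Big\};$$ 2. $$\mathbb E\|f_0-f_{EWA}\|_2^2\le\inf_{\nu\in N}\inf_{\mu}\Big\{(1+\epsilon(\nu))\int\mathbb E\|f_0-\hat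 f_t\|_2^2\,d\mu(t)+(1+\epsilon'(\nu))\int(\operatorname{pen}(t)+\operatorname{price}(t))\,d\mu(t)+2\beta(1+\epsilon'(\nu))KL(\mu,\pi)\Big\}.$$ -/

import Mathlib

open MeasureTheory
open scoped ENNReal RealInnerProductSpace

namespace EWA

noncomputable section

/-- `W` is a centered sub-Gaussian random vector of `ℝⁿ` with parameter `σ2` (written `σ²` on
paper), under the probability measure `Pr`: it is integrable with mean zero, and
`𝔼 exp (αᵀ W) ≤ exp (σ² / 2 * ‖α‖²)` (with finite left-hand side) for every vector `α`. -/
structure IsCenteredSubGaussian {Ω : Type*} [MeasurableSpace Ω] {n : ℕ}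
    (W : Ω → EuclideanSpace ℝ (Fin n)) (σ2 : ℝ) (Pr : Measure Ω) : Prop where
  integrable : Integrable W Pr
  mean_zero : ∫ ω, W ω ∂Pr = 0
  integrable_exp : ∀ α : EuclideanSpace ℝ (Fin n), Integrable (fun ω => Real.exp ⟪α, W ω⟫) Pr
  integral_exp_le : ∀ α : EuclideanSpace ℝ (Fin n),
    ∫ ω, Real.exp ⟪α, W ω⟫ ∂Pr ≤ Real.exp (σ2 / 2 * ‖α‖ ^ 2)

/-- The operator of Euclidean space given by a square matrix, so that `op A y` is `A y` and
`‖op A‖` is the operator norm of `A` for the Euclidean norm. -/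
abbrev op {n : ℕ} (A : Matrix (Fin n) (Fin n) ℝ) :
    EuclideanSpace ℝ (Fin n) →L[ℝ] EuclideanSpace ℝ (Fin n) :=
  Matrix.toEuclideanCLM (n := Fin n) (𝕜 := ℝ) A

/-- Stein's unbiased risk estimate `‖y - A y‖² + 2 σ² tr A - n σ²` of the estimator `A y`. -/
def steinRisk {n : ℕ} (σ2 : ℝ) (A : Matrix (Fin n) (Fin n) ℝ)
    (y : EuclideanSpace ℝ (Fin n)) : ℝ :=
  ‖y - op A y‖ ^ 2 + 2 * σ2 * A.trace - n * σ2

/-- The smallest `C ≥ 0` such that `‖P_t f₀‖² ≤ C² tr (P_t²)` for every `t`. -/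
def tildeNorm {n : ℕ} {T : Type*} (P : T → Matrix (Fin n) (Fin n) ℝ)
    (f₀ : EuclideanSpace ℝ (Fin n)) : ℝ :=
  sInf {C : ℝ | 0 ≤ C ∧ ∀ t, ‖op (P t) f₀‖ ^ 2 ≤ C ^ 2 * (P t ^ 2).trace}

/-- The exponential weights `dρ(t) = exp (-(r_t + pen t) / β) / (∫ exp (-(r + pen) / β) dprior) dprior(t)`
computed from the observation `y`. -/
def gibbs {n : ℕ} {T : Type*} [MeasurableSpace T] (σ2 β : ℝ)
    (P : T → Matrix (Fin n) (Fin n) ℝ) (pen : T → ℝ) (prior : Measure T)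
    (y : EuclideanSpace ℝ (Fin n)) : Measure T :=
  prior.tilted fun t => -(1 / β) * (steinRisk σ2 (P t) y + pen t)

/-- The exponentially weighted aggregate `∫ P_t y dρ(t)`. -/
def ewa {n : ℕ} {T : Type*} [MeasurableSpace T] (σ2 β : ℝ)
    (P : T → Matrix (Fin n) (Fin n) ℝ) (pen : T → ℝ) (prior : Measure T)
    (y : EuclideanSpace ℝ (Fin n)) : EuclideanSpace ℝ (Fin n) :=
  ∫ t, op (P t) y ∂(gibbs σ2 β P pen prior y)

/-- The constant `γ`; it is zero when `δ = 0`. -/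
def gam (σ2 V β δ : ℝ) : ℝ :=
  if 0 < δ then
    (β - 4 * σ2 * V * (1 + 2 * δ)
        - Real.sqrt (β - 4 * σ2 * V) * Real.sqrt (β - 4 * σ2 * V * (1 + 4 * δ)))
      / (16 * σ2 * δ * V ^ 2)
  else 0

/-- The least penalty allowed for the matrix `A`, where `C` stands for the value `tildeNorm P f₀`. -/
def penBound {n : ℕ} (σ2 V β δ C : ℝ) (A : Matrix (Fin n) (Fin n) ℝ) : ℝ :=
  4 * σ2 / (β - 4 * σ2 * V) *
    (1 + (1 - δ) * (1 + 2 * gam σ2 V β δ * V) ^ 2 * (C ^ 2 / σ2)) * (A ^ 2).trace * σ2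

/-- The price of the matrix `A`, where `C` stands for the value `tildeNorm P f₀`. -/
def price {n : ℕ} (σ2 V β δ C : ℝ) (A : Matrix (Fin n) (Fin n) ℝ) : ℝ :=
  2 * σ2 * (A.trace +
    2 * σ2 * (1 - δ) * (1 + 2 * gam σ2 V β δ * V) ^ 2 / (β - 4 * σ2 * V)
      * (C ^ 2 / σ2) * (A ^ 2).trace)

/-- `ε'(ν)`. -/
def eps' (γ ν : ℝ) : ℝ := 1 / (1 - (1 + ν) * γ) - 1

/-- `ε(ν)`. -/
def eps (γ ν : ℝ) : ℝ := (1 + ν) ^ 2 * γ / (ν * (1 - (1 + ν) * γ))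

/-- The set `N` of admissible `ν`. -/
def admissible (γ : ℝ) : Set ℝ := {ν | 0 < ν ∧ (1 + ν) * γ < 1}

end

end EWA

/-!
The proof compares the aggregate with a competitor `μ` through the exponential moment of a pair of
smoothers. Write `F t = P t Y`, let `ρ` be the exponential weights and `m = ∫ F dρ` the aggregate.
Stein's risk splits as `r t = ‖f₀ - F t‖² + ℓ t`, where `ℓ t` (`steinNoise`) involves `F t` only
through `-2 ⟪W, F t⟫ + 2 σ² tr (P t)`, up to a term that does not depend on `t`.

*Deterministic part* (`pacBayes_oracle`). The bias–variance identity under `ρ` leaves the negative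
term `-∫ ‖F t - m‖² dρ`, which pays for the variance part of `γ ∫ ‖F u - F t‖² dρ(t)` as soon as
`γ ≤ 1`. The Donsker–Varadhan inequality for `μ` is used twice: with the exponent of `ρ`, and with
the function of `u` obtained from the exponent
`(ℓ u - ℓ t - γ ‖F u - F t‖² - price u - pen t) / β` by Jensen's inequality under `ρ`. This explains
the factor `2` in front of the Kullback–Leibler divergence. The outcome is an upper bound for
`‖f₀ - m‖²` by the risk and the penalties of `μ`, by `γ ∫ ‖m - F u‖² dμ(u)`, and by `β log Z`, where
`Z` (`evidence`) is the integral of the exponential of the exponent over pairs `(t, u)`. Splitting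
`‖m - F u‖² ≤ (1 + ν) ‖f₀ - m‖² + (1 + 1 / ν) ‖f₀ - F u‖²` produces `ε` and `ε'`.

*Random part* (`lintegral_evidence_le_one`). `𝔼 Z ≤ 1`, because every pair has exponential moment
at most one. With `D = P t - P u`, the quadratic part of the exponent is at most
`2 ⟪W, P t W⟫`, as `P u` is positive semi-definite and `γ ≥ 0`, and its linear part
is `2 ⟪(1 - γ D) D f₀, W⟫`.
Such an exponential moment is bounded by writing the exponential of a square as a Gaussian mixture
of exponentials of linear forms, in an eigenbasis of `P t` (`lintegral_exp_quadratic_le`). The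
constant `γ` is the root of `2 σ² δ (1 + 2 γ V)² = γ (β - 4 σ² V)`: the negative term `-γ ‖D f₀‖²`
absorbs a proportion `δ` of the cost of the linear part, and the penalty of `t` and the price of `u`
absorb the rest.

The bound in probability follows from Markov's inequality for `Z`, the bound in expectation from
`log Z ≤ Z - 1`.
-/

namespace EWA

/-! ### Exponential moments of quadratic forms of sub-Gaussian vectors -/

/-- This is `log y ≤ sinh (log y) = (y - y⁻¹) / 2` at `y = (1 - x)⁻¹`. -/
lemma inv_le_exp_of_lt_one {x : ℝ} (hx0 : 0 ≤ x) (hx1 : x < 1) :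
    (1 - x)⁻¹ ≤ Real.exp (x + x ^ 2 / (2 * (1 - x))) := by
  have h1 : 0 < 1 - x := by linarith
  have hlog : 0 ≤ Real.log (1 - x)⁻¹ :=
    Real.log_nonneg (by rw [one_le_inv₀ h1]; linarith)
  have h := Real.self_le_sinh_iff.mpr hlog
  rw [Real.sinh_eq, Real.exp_neg, Real.exp_log (inv_pos.mpr h1), inv_inv] at h
  have e : ((1 - x)⁻¹ - (1 - x)) / 2 = x + x ^ 2 / (2 * (1 - x)) := by
    field_simp; ring
  rw [e] at h
  calc (1 - x)⁻¹ = Real.exp (Real.log (1 - x)⁻¹) := (Real.exp_log (inv_pos.mpr h1)).symm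
    _ ≤ _ := Real.exp_le_exp.mpr h

/-- Completing the square: a Gaussian density times the exponential of a square is a multiple of
another Gaussian density. -/
lemma exp_sq_mul_gaussianPDFReal {s a c : ℝ} (v : NNReal) (hx1 : s * a ^ 2 < 1)
    (hv : (v : ℝ) = (1 - s * a ^ 2)⁻¹) (g : ℝ) :
    ProbabilityTheory.gaussianPDFReal 0 1 g * Real.exp (s / 2 * (a * g + c) ^ 2) =
      √v * Real.exp (s * c ^ 2 / (2 * (1 - s * a ^ 2))) *
        ProbabilityTheory.gaussianPDFReal (s * a * c * v) v g := by
  have h1 : 0 < 1 - s * a ^ 2 := by linarith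
  have hvpos : (0 : ℝ) < v := by rw [hv]; positivity
  simp only [ProbabilityTheory.gaussianPDFReal]
  have hs : √(2 * Real.pi * v) = √(2 * Real.pi) * √v := Real.sqrt_mul (by positivity) _
  have hsv : √(v : ℝ) ≠ 0 := (Real.sqrt_pos.mpr hvpos).ne'
  rw [hs, mul_inv]
  have e : -(g - 0) ^ 2 / (2 * ((1 : NNReal) : ℝ)) + s / 2 * (a * g + c) ^ 2 =
      s * c ^ 2 / (2 * (1 - s * a ^ 2)) + -(g - s * a * c * v) ^ 2 / (2 * v) := by
    rw [hv]; push_cast; field_simp; ring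
  calc _ = (√(2 * Real.pi))⁻¹ * Real.exp (-(g - 0) ^ 2 / (2 * ((1 : NNReal) : ℝ)) +
        s / 2 * (a * g + c) ^ 2) := by rw [Real.exp_add]; simp; ring
    _ = _ := by rw [e, Real.exp_add]; field_simp

lemma integrable_exp_sq_gaussianReal {s a : ℝ} (c : ℝ) (hx1 : s * a ^ 2 < 1) :
    Integrable (fun g => Real.exp (s / 2 * (a * g + c) ^ 2))
      (ProbabilityTheory.gaussianReal 0 1) := by
  have h1 : 0 < 1 - s * a ^ 2 := by linarith
  let v : NNReal := ⟨(1 - s * a ^ 2)⁻¹, by positivity⟩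
  rw [ProbabilityTheory.gaussianReal_of_var_ne_zero _ one_ne_zero]
  rw [integrable_withDensity_iff_integrable_smul' (by fun_prop)
    (by simp [ProbabilityTheory.gaussianPDF])]
  simp only [ProbabilityTheory.toReal_gaussianPDF, smul_eq_mul]
  simp_rw [exp_sq_mul_gaussianPDFReal v hx1 rfl]
  exact (ProbabilityTheory.integrable_gaussianPDFReal _ _).const_mul _

lemma integral_exp_sq_gaussianReal_le {s a : ℝ} (c : ℝ) (hs : 0 ≤ s) (hx1 : s * a ^ 2 < 1) :
    ∫ g, Real.exp (s / 2 * (a * g + c) ^ 2) ∂(ProbabilityTheory.gaussianReal 0 1) ≤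
      Real.exp (s * a ^ 2 / 2 + (s * a ^ 2) ^ 2 / (4 * (1 - s * a ^ 2)) +
        s * c ^ 2 / (2 * (1 - s * a ^ 2))) := by
  have h1 : 0 < 1 - s * a ^ 2 := by linarith
  let v : NNReal := ⟨(1 - s * a ^ 2)⁻¹, by positivity⟩
  have hv0 : v ≠ 0 := by
    intro h
    have : (v : ℝ) = 0 := by simp [h]
    exact (inv_pos.mpr h1).ne' this
  rw [ProbabilityTheory.integral_gaussianReal_eq_integral_smul one_ne_zero]
  simp only [smul_eq_mul]
  simp_rw [exp_sq_mul_gaussianPDFReal v hx1 rfl]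
  rw [integral_const_mul, ProbabilityTheory.integral_gaussianPDFReal_eq_one _ hv0, mul_one,
    Real.exp_add]
  gcongr
  rw [Real.sqrt_le_left (Real.exp_pos _).le, ← Real.exp_nat_mul]
  refine (inv_le_exp_of_lt_one (by positivity) hx1).trans (Real.exp_le_exp.mpr (le_of_eq ?_))
  push_cast; field_simp; ring

/-- Decoupling: `exp (a² x² / 2)` is the average of `exp (a g x)` over a standard Gaussian `g`, so
the exponential of a quadratic form in `W` is an average of exponentials of linear forms, to which
the sub-Gaussian bound applies. What remains is a product of one-dimensional Gaussian integrals. -/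
lemma lintegral_exp_quadratic_le {Ω : Type*} [MeasurableSpace Ω] {Pr : Measure Ω} [SFinite Pr]
    {n : ℕ} {W : Ω → EuclideanSpace ℝ (Fin n)} {s : ℝ} (hWm : Measurable W) (hs : 0 ≤ s)
    (hW : IsCenteredSubGaussian W s Pr) {ι : Type*} [Fintype ι]
    (v : OrthonormalBasis ι ℝ (EuclideanSpace ℝ (Fin n))) (a c : ι → ℝ)
    (ha : ∀ i, s * a i ^ 2 < 1) :
    ∫⁻ ω, ENNReal.ofReal (Real.exp (∑ i, (a i ^ 2 / 2 * ⟪v i, W ω⟫ ^ 2 + c i * ⟪v i, W ω⟫))) ∂Pr ≤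
      ENNReal.ofReal (Real.exp (∑ i, (s * a i ^ 2 / 2 +
        (s * a i ^ 2) ^ 2 / (4 * (1 - s * a i ^ 2)) + s * c i ^ 2 / (2 * (1 - s * a i ^ 2))))) := by
  classical
  let G : Measure (ι → ℝ) := Measure.pi fun _ => ProbabilityTheory.gaussianReal 0 1
  -- the random linear form attached to the auxiliary Gaussian vector `g`
  let α : (ι → ℝ) → EuclideanSpace ℝ (Fin n) := fun g => ∑ i, (a i * g i + c i) • v i
  have hα : ∀ g w, ⟪α g, w⟫ = ∑ i, (a i * g i + c i) * ⟪v i, w⟫ := by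
    intro g w; simp [α, sum_inner, inner_smul_left]
  have hαn : ∀ g, ‖α g‖ ^ 2 = ∑ i, (a i * g i + c i) ^ 2 := by
    intro g
    rw [← real_inner_self_eq_norm_sq, hα]
    refine Finset.sum_congr rfl fun i _ => ?_
    rw [v.orthonormal.inner_right_fintype (fun i => a i * g i + c i) i, pow_two]
  have hαm : Measurable α := by fun_prop
  have hdec : ∀ w : EuclideanSpace ℝ (Fin n),
      ENNReal.ofReal (Real.exp (∑ i, (a i ^ 2 / 2 * ⟪v i, w⟫ ^ 2 + c i * ⟪v i, w⟫))) =
        ∫⁻ g, ENNReal.ofReal (Real.exp ⟪α g, w⟫) ∂G := by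
    intro w
    have hi : ∀ i, Integrable (fun x => Real.exp ((a i * x + c i) * ⟪v i, w⟫))
        (ProbabilityTheory.gaussianReal 0 1) := by
      intro i
      have := (ProbabilityTheory.integrable_exp_mul_gaussianReal (μ := 0) (v := 1)
        (a i * ⟪v i, w⟫)).const_mul (Real.exp (c i * ⟪v i, w⟫))
      refine this.congr (ae_of_all _ fun x => ?_)
      simp only [← Real.exp_add]; congr 1; ring
    have hval : ∀ i, ∫ x, Real.exp ((a i * x + c i) * ⟪v i, w⟫)
        ∂(ProbabilityTheory.gaussianReal 0 1) =
          Real.exp (a i ^ 2 / 2 * ⟪v i, w⟫ ^ 2 + c i * ⟪v i, w⟫) := by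
      intro i
      have h := congrFun (ProbabilityTheory.mgf_fun_id_gaussianReal (μ := 0) (v := 1))
        (a i * ⟪v i, w⟫)
      simp only [ProbabilityTheory.mgf] at h
      have e : ∀ x, Real.exp ((a i * x + c i) * ⟪v i, w⟫) =
          Real.exp (c i * ⟪v i, w⟫) * Real.exp (a i * ⟪v i, w⟫ * x) := by
        intro x; rw [← Real.exp_add]; congr 1; ring
      simp_rw [e]
      rw [integral_const_mul, h, ← Real.exp_add]; congr 1; push_cast; ring
    have hp : ∀ g, Real.exp ⟪α g, w⟫ = ∏ i, Real.exp ((a i * g i + c i) * ⟪v i, w⟫) := by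
      intro g; rw [hα, Real.exp_sum]
    rw [← ofReal_integral_eq_lintegral_ofReal]
    · congr 1
      simp_rw [hp]
      rw [integral_fintype_prod_eq_prod (f := fun i x => Real.exp ((a i * x + c i) * ⟪v i, w⟫)),
        Real.exp_sum]
      simp_rw [hval]
    · simp_rw [hp]
      exact Integrable.fintype_prod hi
    · exact ae_of_all _ fun _ => (Real.exp_pos _).le
  calc _ = ∫⁻ ω, ∫⁻ g, ENNReal.ofReal (Real.exp ⟪α g, W ω⟫) ∂G ∂Pr := by simp_rw [hdec]
    _ = ∫⁻ g, ∫⁻ ω, ENNReal.ofReal (Real.exp ⟪α g, W ω⟫) ∂Pr ∂G := by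
      rw [lintegral_lintegral_swap]
      refine Measurable.aemeasurable ?_
      simp only [Function.uncurry_def]
      fun_prop
    _ ≤ ∫⁻ g, ENNReal.ofReal (∏ i, Real.exp (s / 2 * (a i * g i + c i) ^ 2)) ∂G := by
      refine lintegral_mono fun g => ?_
      rw [← ofReal_integral_eq_lintegral_ofReal (hW.integrable_exp _)
        (ae_of_all _ fun _ => (Real.exp_pos _).le)]
      refine ENNReal.ofReal_le_ofReal ((hW.integral_exp_le _).trans (le_of_eq ?_))
      rw [hαn, Finset.mul_sum, Real.exp_sum]
    _ = ENNReal.ofReal (∏ i, ∫ x, Real.exp (s / 2 * (a i * x + c i) ^ 2)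
          ∂(ProbabilityTheory.gaussianReal 0 1)) := by
      rw [← ofReal_integral_eq_lintegral_ofReal]
      · rw [integral_fintype_prod_eq_prod (f := fun i x => Real.exp (s / 2 * (a i * x + c i) ^ 2))]
      · exact Integrable.fintype_prod fun i => integrable_exp_sq_gaussianReal (c i) (ha i)
      · exact ae_of_all _ fun _ => Finset.prod_nonneg fun _ _ => (Real.exp_pos _).le
    _ ≤ _ := by
      refine ENNReal.ofReal_le_ofReal ?_
      rw [Real.exp_sum]
      exact Finset.prod_le_prod (fun i _ => integral_nonneg fun _ => (Real.exp_pos _).le)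
        fun i _ => integral_exp_sq_gaussianReal_le (c i) hs (ha i)

/-! ### Smoothing matrices in an eigenbasis -/

section Matrix

variable {n : ℕ} {A : Matrix (Fin n) (Fin n) ℝ}

lemma inner_op_left (hA : A.IsHermitian) (x y : EuclideanSpace ℝ (Fin n)) :
    ⟪op A x, y⟫ = ⟪x, op A y⟫ :=
  Matrix.isSymmetric_toEuclideanLin_iff.mpr hA x y

lemma inner_op_nonneg (hA : A.PosSemidef) (x : EuclideanSpace ℝ (Fin n)) : 0 ≤ ⟪x, op A x⟫ := by
  rw [Matrix.inner_toEuclideanCLM]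
  simpa using hA.dotProduct_mulVec_nonneg x.ofLp

lemma op_eigenvectorBasis (hA : A.IsHermitian) (i : Fin n) :
    op A (hA.eigenvectorBasis i) = hA.eigenvalues i • hA.eigenvectorBasis i := by
  have h := hA.mulVec_eigenvectorBasis i
  ext j
  simpa using congrFun h j

lemma eigenvalues_le_norm_op (hA : A.IsHermitian) (i : Fin n) : hA.eigenvalues i ≤ ‖op A‖ := by
  have h1 : ‖hA.eigenvectorBasis i‖ = 1 := hA.eigenvectorBasis.orthonormal.1 i
  have h := (op A).le_opNorm (hA.eigenvectorBasis i)
  rw [op_eigenvectorBasis hA, norm_smul, h1, mul_one, mul_one] at h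
  exact (le_abs_self _).trans h

lemma inner_op_self_eq_sum (hA : A.IsHermitian) (x : EuclideanSpace ℝ (Fin n)) :
    ⟪x, op A x⟫ = ∑ i, hA.eigenvalues i * ⟪hA.eigenvectorBasis i, x⟫ ^ 2 := by
  rw [← hA.eigenvectorBasis.sum_inner_mul_inner]
  refine Finset.sum_congr rfl fun i _ => ?_
  rw [← inner_op_left hA, op_eigenvectorBasis hA, real_inner_smul_left, real_inner_comm]
  ring

lemma trace_sq_eq_sum (hA : A.IsHermitian) : (A ^ 2).trace = ∑ i, hA.eigenvalues i ^ 2 := by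
  conv_lhs => rw [hA.spectral_theorem]
  rw [← map_pow, Unitary.conjStarAlgAut_apply, Matrix.trace_mul_cycle,
    Unitary.coe_star_mul_self, one_mul, Matrix.diagonal_pow]
  simp [Matrix.trace]

lemma trace_sq_nonneg (hA : A.IsHermitian) : 0 ≤ (A ^ 2).trace := by
  rw [trace_sq_eq_sum hA]; positivity

/-- The operator norm is at most the Frobenius norm. -/
lemma norm_op_apply_sq_le (hA : A.IsHermitian) (x : EuclideanSpace ℝ (Fin n)) :
    ‖op A x‖ ^ 2 ≤ ‖x‖ ^ 2 * (A ^ 2).trace := by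
  rw [trace_sq_eq_sum hA, ← hA.eigenvectorBasis.sum_sq_norm_inner_right (op A x), Finset.mul_sum]
  refine Finset.sum_le_sum fun i _ => ?_
  have h1 : ‖hA.eigenvectorBasis i‖ = 1 := hA.eigenvectorBasis.orthonormal.1 i
  have h2 := norm_inner_le_norm (𝕜 := ℝ) (hA.eigenvectorBasis i) x
  rw [← inner_op_left hA, op_eigenvectorBasis hA, real_inner_smul_left, norm_mul, mul_pow]
  rw [h1, one_mul] at h2
  rw [Real.norm_eq_abs, sq_abs, mul_comm]
  gcongr

lemma trace_le_of_norm_op_le (hA : A.IsHermitian) {V : ℝ} (hV : ‖op A‖ ≤ V) :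
    A.trace ≤ n * V := by
  rw [hA.trace_eq_sum_eigenvalues]
  calc _ ≤ ∑ _i : Fin n, V :=
        Finset.sum_le_sum fun i _ => (eigenvalues_le_norm_op hA i).trans hV
    _ = n * V := by simp

lemma trace_sq_le_of_norm_op_le (hA : A.PosSemidef) {V : ℝ} (hV : ‖op A‖ ≤ V) :
    (A ^ 2).trace ≤ n * V ^ 2 := by
  rw [trace_sq_eq_sum hA.1]
  calc _ ≤ ∑ _i : Fin n, V ^ 2 := by
        refine Finset.sum_le_sum fun i _ => ?_
        have := hA.eigenvalues_nonneg i
        have := (eigenvalues_le_norm_op hA.1 i).trans hV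
        gcongr
    _ = n * V ^ 2 := by simp

end Matrix

/-! ### The exponential moment of a pair of smoothers -/

/-- The bound of `lintegral_exp_quadratic_le` in an eigenbasis of `A`. The two traces are the first
and second order terms of the logarithm of the determinant of `1 - (4 * s / β) • A`. -/
lemma lintegral_exp_inner_op_le {Ω : Type*} [MeasurableSpace Ω] {Pr : Measure Ω} [SFinite Pr]
    {n : ℕ} {W : Ω → EuclideanSpace ℝ (Fin n)} {s V β : ℝ} (hWm : Measurable W) (hs : 0 < s)
    (hW : IsCenteredSubGaussian W s Pr) {A : Matrix (Fin n) (Fin n) ℝ} (hA : A.PosSemidef)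
    (hV : 0 < V) (hAV : ‖op A‖ ≤ V) (hβ : 4 * s * V < β) (b : EuclideanSpace ℝ (Fin n)) :
    ∫⁻ ω, ENNReal.ofReal (Real.exp (2 / β * (⟪W ω, op A (W ω)⟫ + ⟪b, W ω⟫))) ∂Pr ≤
      ENNReal.ofReal (Real.exp (1 / β * (2 * s * A.trace +
        (4 * s ^ 2 * (A ^ 2).trace + 2 * s * ‖b‖ ^ 2) / (β - 4 * s * V)))) := by
  have hβ0 : 0 < β := lt_of_le_of_lt (by positivity) hβ
  set v := hA.1.eigenvectorBasis
  set l := hA.1.eigenvalues with hl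
  have hl0 : ∀ i, 0 ≤ l i := hA.eigenvalues_nonneg
  have hlV : ∀ i, l i ≤ V := fun i => (eigenvalues_le_norm_op hA.1 i).trans hAV
  have ha2 : ∀ i, √(4 * l i / β) ^ 2 = 4 * l i / β := fun i =>
    Real.sq_sqrt (by have := hl0 i; positivity)
  have hgap : ∀ i, β - 4 * s * V ≤ β - 4 * s * l i := by
    intro i; have := mul_le_mul_of_nonneg_left (hlV i) hs.le; linarith
  have hB : 0 < β - 4 * s * V := by linarith
  have hx : ∀ i, s * (4 * l i / β) = 1 - (β - 4 * s * l i) / β := by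
    intro i; field_simp; ring
  have ha1 : ∀ i, s * √(4 * l i / β) ^ 2 < 1 := by
    intro i
    rw [ha2, hx]
    have := hgap i
    have : 0 < (β - 4 * s * l i) / β := by apply div_pos <;> linarith
    linarith
  -- `a i ^ 2 / 2 = 2 * l i / β` is the coefficient of the square of the `i`-th coordinate
  have key := lintegral_exp_quadratic_le hWm hs.le hW v (fun i => √(4 * l i / β))
    (fun i => 2 / β * ⟪v i, b⟫) ha1
  refine le_trans (le_of_eq ?_) (key.trans (ENNReal.ofReal_le_ofReal (Real.exp_le_exp.mpr ?_)))
  · refine lintegral_congr fun ω => ?_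
    congr 2
    rw [inner_op_self_eq_sum hA.1, ← v.sum_inner_mul_inner b (W ω), ← Finset.sum_add_distrib,
      Finset.mul_sum]
    refine Finset.sum_congr rfl fun i _ => ?_
    rw [ha2, real_inner_comm (v i) b]
    ring
  · rw [hA.1.trace_eq_sum_eigenvalues, trace_sq_eq_sum hA.1, ← v.sum_sq_norm_inner_right b]
    simp only [Finset.mul_sum, ← Finset.sum_add_distrib, Finset.sum_div]
    refine Finset.sum_le_sum fun i _ => ?_
    simp only [RCLike.ofReal_real_eq_id, id]
    rw [ha2, ← hl]
    have hg := hgap i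
    have hg0 : 0 < β - 4 * s * l i := by linarith
    have e : 1 - s * (4 * l i / β) = (β - 4 * s * l i) / β := by rw [hx]; ring
    rw [e]
    have e2 : s * (4 * l i / β) / 2 + (s * (4 * l i / β)) ^ 2 / (4 * ((β - 4 * s * l i) / β)) +
        s * (2 / β * ⟪v i, b⟫) ^ 2 / (2 * ((β - 4 * s * l i) / β)) =
        1 / β * (2 * s * l i +
          (4 * s ^ 2 * l i ^ 2 + 2 * s * ⟪v i, b⟫ ^ 2) / (β - 4 * s * l i)) := by
      field_simp; ring
    rw [e2, Real.norm_eq_abs, sq_abs]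
    gcongr

/-- `γ` is the smaller root of a quadratic equation in which `δ` is the proportion of the cost of
the linear part of the noise that is compensated by the term in `γ`. -/
lemma gam_nonneg_and_eq {s V β δ : ℝ} (hs : 0 < s) (hV : 0 < V) (hβ : 4 * s * V < β)
    (hδ : 0 ≤ δ) (hβδ : 4 * s * V * (1 + 4 * δ) ≤ β) :
    0 ≤ gam s V β δ ∧
      2 * s * δ * (1 + 2 * gam s V β δ * V) ^ 2 = gam s V β δ * (β - 4 * s * V) := by
  unfold gam
  split_ifs with h
  · set B := β - 4 * s * V with hB
    have hB0 : 0 < B := by linarith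
    have e1 : β - 4 * s * V * (1 + 4 * δ) = B - 16 * s * δ * V := by rw [hB]; ring
    have e2 : β - 4 * s * V * (1 + 2 * δ) = B - 8 * s * δ * V := by rw [hB]; ring
    have hsv : 0 < s * δ * V := by positivity
    have hB1 : 0 ≤ B - 16 * s * δ * V := by rw [← e1]; linarith
    rw [e1, e2, ← Real.sqrt_mul hB0.le]
    set R := √(B * (B - 16 * s * δ * V)) with hR
    have hR2 : R ^ 2 = B * (B - 16 * s * δ * V) := Real.sq_sqrt (by positivity)
    have hR0 : 0 ≤ R := Real.sqrt_nonneg _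
    have hle : R ≤ B - 8 * s * δ * V := by
      apply Real.sqrt_le_iff.mpr
      constructor
      · linarith
      · nlinarith [sq_nonneg (s * δ * V)]
    refine ⟨div_nonneg (by linarith) (by positivity), ?_⟩
    field_simp
    linear_combination (8 : ℝ) * hR2
  · have : δ = 0 := le_antisymm (not_lt.mp h) hδ
    simp [this]

/-- The infimum defining `tildeNorm` is attained: the set is closed, and it contains `‖f₀‖`. -/
lemma norm_op_sq_le_tildeNorm {n : ℕ} {T : Type*} {P : T → Matrix (Fin n) (Fin n) ℝ}
    (hP : ∀ t, (P t).IsHermitian) (f₀ : EuclideanSpace ℝ (Fin n)) (t : T) :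
    ‖op (P t) f₀‖ ^ 2 ≤ tildeNorm P f₀ ^ 2 * (P t ^ 2).trace := by
  have hcl : IsClosed {C : ℝ | 0 ≤ C ∧ ∀ t, ‖op (P t) f₀‖ ^ 2 ≤ C ^ 2 * (P t ^ 2).trace} := by
    simp only [Set.ofPred_and, Set.ofPred_forall]
    refine (isClosed_le (by fun_prop) (by fun_prop)).inter
      (isClosed_iInter fun t => isClosed_le (by fun_prop) (by fun_prop))
  exact (hcl.csInf_mem ⟨‖f₀‖, norm_nonneg _, fun t => norm_op_apply_sq_le (hP t) f₀⟩
    ⟨0, fun C hC => hC.1⟩).2 t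

/-- The calibration of the penalty and of `γ`: for two smoothers `A` and `B`, the penalty of `A`,
the price of `B` and the quadratic term in `γ` make the exponential moment of the noise at most
one. -/
lemma lintegral_exp_pair_le_one {Ω : Type*} [MeasurableSpace Ω] {Pr : Measure Ω} [SFinite Pr]
    {n : ℕ} {W : Ω → EuclideanSpace ℝ (Fin n)} {s V β δ C : ℝ} (hWm : Measurable W) (hs : 0 < s)
    (hW : IsCenteredSubGaussian W s Pr) {A B : Matrix (Fin n) (Fin n) ℝ} (hA : A.PosSemidef)
    (hB : B.PosSemidef) (hV : 0 < V) (hAV : ‖op A‖ ≤ V) (hBV : ‖op B‖ ≤ V) (hβ : 4 * s * V < β)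
    (hδ : δ ∈ Set.Icc (0 : ℝ) 1) (hβδ : 4 * s * V * (1 + 4 * δ) ≤ β)
    (f₀ : EuclideanSpace ℝ (Fin n)) (hCA : ‖op A f₀‖ ^ 2 ≤ C ^ 2 * (A ^ 2).trace)
    (hCB : ‖op B f₀‖ ^ 2 ≤ C ^ 2 * (B ^ 2).trace) {p : ℝ} (hp : penBound s V β δ C A ≤ p) :
    ∫⁻ ω, ENNReal.ofReal (Real.exp (1 / β *
      (2 * ⟪W ω, op A (f₀ + W ω) - op B (f₀ + W ω)⟫ - 2 * s * A.trace + 2 * s * B.trace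
        - gam s V β δ * ‖op A (f₀ + W ω) - op B (f₀ + W ω)‖ ^ 2
        - price s V β δ C B - p))) ∂Pr ≤ 1 := by
  obtain ⟨hγ0, hγ⟩ := gam_nonneg_and_eq hs hV hβ hδ.1 hβδ
  have hβ0 : 0 < β := lt_of_le_of_lt (by positivity) hβ
  have hG : 0 < β - 4 * s * V := by linarith
  set γ := gam s V β δ with hγdef
  let D := op A - op B
  have hDs : ∀ x y, ⟪D x, y⟫ = ⟪x, D y⟫ := by
    intro x y
    simp only [D, sub_apply, inner_sub_left, inner_sub_right,
      inner_op_left hA.1, inner_op_left hB.1]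
  have hDV : ‖D‖ ≤ 2 * V := (norm_sub_le _ _).trans (by linarith)
  -- the noise acts linearly through `b`, once the square in `γ` is expanded
  let b := D f₀ - γ • D (D f₀)
  have hb : ‖b‖ ^ 2 ≤ (1 + 2 * γ * V) ^ 2 * ‖D f₀‖ ^ 2 := by
    rw [← mul_pow]
    gcongr
    calc ‖b‖ ≤ ‖D f₀‖ + ‖γ • D (D f₀)‖ := norm_sub_le _ _
      _ ≤ ‖D f₀‖ + γ * (2 * V * ‖D f₀‖) := by
        rw [norm_smul, Real.norm_of_nonneg hγ0]
        gcongr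
        exact D.le_of_opNorm_le hDV _
      _ = _ := by ring
  have hDf : ‖D f₀‖ ^ 2 ≤ 2 * (C ^ 2 * (A ^ 2).trace) + 2 * (C ^ 2 * (B ^ 2).trace) := by
    have h := parallelogram_law_with_norm ℝ (op A f₀) (op B f₀)
    have : D f₀ = op A f₀ - op B f₀ := rfl
    rw [this]
    nlinarith [mul_self_nonneg ‖op A f₀ + op B f₀‖]
  -- the part of the cost of `b` that is left to the penalty and the price
  let K := (2 * s * (1 - δ) * (1 + 2 * γ * V) ^ 2) / (β - 4 * s * V)
  have hK0 : 0 ≤ K := by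
    have := hδ.2
    have : 0 ≤ 1 - δ := by linarith
    positivity
  have hcost : 2 * s * ‖b‖ ^ 2 / (β - 4 * s * V) ≤
      γ * ‖D f₀‖ ^ 2 + 2 * K * (C ^ 2 * (A ^ 2).trace) + 2 * K * (C ^ 2 * (B ^ 2).trace) := by
    calc _ ≤ 2 * s * ((1 + 2 * γ * V) ^ 2 * ‖D f₀‖ ^ 2) / (β - 4 * s * V) := by gcongr
      _ = γ * ‖D f₀‖ ^ 2 + K * ‖D f₀‖ ^ 2 := by
        simp only [K]
        rw [div_eq_iff hG.ne', add_mul, div_mul_eq_mul_div, div_mul_cancel₀ _ hG.ne']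
        linear_combination ‖D f₀‖ ^ 2 * hγ
      _ ≤ _ := by nlinarith [mul_le_mul_of_nonneg_left hDf hK0]
  have hpA : penBound s V β δ C A =
      4 * s ^ 2 * (A ^ 2).trace / (β - 4 * s * V) + 2 * K * (C ^ 2 * (A ^ 2).trace) := by
    simp only [penBound, K, ← hγdef]; field_simp; ring
  have hpB : price s V β δ C B = 2 * s * B.trace + 2 * K * (C ^ 2 * (B ^ 2).trace) := by
    simp only [price, K, ← hγdef]; field_simp
  have hexp : ∀ w : EuclideanSpace ℝ (Fin n),
      2 * ⟪w, op A (f₀ + w) - op B (f₀ + w)⟫ - γ * ‖op A (f₀ + w) - op B (f₀ + w)‖ ^ 2 ≤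
        2 * (⟪w, op A w⟫ + ⟪b, w⟫) - γ * ‖D f₀‖ ^ 2 := by
    intro w
    have e1 : op A (f₀ + w) - op B (f₀ + w) = D f₀ + D w := by rw [← map_add]; rfl
    have e2 : ⟪w, D w⟫ = ⟪w, op A w⟫ - ⟪w, op B w⟫ := by
      simp [D, inner_sub_right]
    have e3 : ⟪b, w⟫ = ⟪w, D f₀⟫ - γ * ⟪D f₀, D w⟫ := by
      simp only [b, inner_sub_left, real_inner_smul_left]
      rw [hDs (D f₀) w, real_inner_comm w]
    rw [e1, norm_add_sq_real, inner_add_right, e2, e3]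
    nlinarith [inner_op_nonneg hB w, mul_nonneg hγ0 (sq_nonneg ‖D w‖)]
  set c := 1 / β * (2 * s * A.trace +
        (4 * s ^ 2 * (A ^ 2).trace + 2 * s * ‖b‖ ^ 2) / (β - 4 * s * V)) with hc
  have hbound : ∀ w : EuclideanSpace ℝ (Fin n), 1 / β *
      (2 * ⟪w, op A (f₀ + w) - op B (f₀ + w)⟫ - 2 * s * A.trace + 2 * s * B.trace
        - γ * ‖op A (f₀ + w) - op B (f₀ + w)‖ ^ 2 - price s V β δ C B - p) ≤
      -c + 2 / β * (⟪w, op A w⟫ + ⟪b, w⟫) := by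
    intro w
    have e : -c + 2 / β * (⟪w, op A w⟫ + ⟪b, w⟫) = 1 / β * (2 * (⟪w, op A w⟫ + ⟪b, w⟫) -
        (2 * s * A.trace + (4 * s ^ 2 * (A ^ 2).trace / (β - 4 * s * V) +
          2 * s * ‖b‖ ^ 2 / (β - 4 * s * V)))) := by
      rw [hc, add_div]; ring
    rw [e]
    refine mul_le_mul_of_nonneg_left ?_ (by positivity)
    have := hexp w
    linarith
  calc _ ≤ ∫⁻ ω, ENNReal.ofReal (Real.exp (-c)) *
        ENNReal.ofReal (Real.exp (2 / β * (⟪W ω, op A (W ω)⟫ + ⟪b, W ω⟫))) ∂Pr := by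
        refine lintegral_mono fun ω => ?_
        rw [← ENNReal.ofReal_mul (Real.exp_pos _).le, ← Real.exp_add]
        exact ENNReal.ofReal_le_ofReal (Real.exp_le_exp.mpr (hbound (W ω)))
    _ ≤ ENNReal.ofReal (Real.exp (-c)) * ENNReal.ofReal (Real.exp c) := by
        rw [lintegral_const_mul' _ _ ENNReal.ofReal_ne_top]
        gcongr
        exact lintegral_exp_inner_op_le hWm hs hW hA hV hAV hβ b
    _ = 1 := by
        rw [← ENNReal.ofReal_mul (Real.exp_pos _).le, ← Real.exp_add]; simp

/-! ### A deterministic PAC-Bayesian inequality -/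

open InformationTheory in
/-- The Donsker–Varadhan inequality: it is the nonnegativity of the divergence of `μ` from
`π.tilted f`. -/
lemma integral_le_klDiv_add_log {T : Type*} [MeasurableSpace T] {μ π : Measure T}
    [IsProbabilityMeasure μ] [IsProbabilityMeasure π] {f : T → ℝ} (hKL : klDiv μ π ≠ ∞)
    (hfμ : Integrable f μ) (hfπ : Integrable (fun t => Real.exp (f t)) π) :
    ∫ t, f t ∂μ ≤ (klDiv μ π).toReal + Real.log (∫ t, Real.exp (f t) ∂π) := by
  obtain ⟨hac, hint⟩ := klDiv_ne_top_iff.mp hKL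
  have : IsProbabilityMeasure (π.tilted f) := isProbabilityMeasure_tilted hfπ
  have hac' : μ ≪ π.tilted f := hac.trans (absolutelyContinuous_tilted hfπ)
  have h0 := toReal_klDiv_of_measure_eq hac' (by simp)
  rw [integral_llr_tilted_right hac hfμ hfπ hint,
    ← toReal_klDiv_of_measure_eq hac (by simp)] at h0
  have : 0 ≤ (klDiv μ (π.tilted f)).toReal := ENNReal.toReal_nonneg
  linarith

section PACBayes

variable {T E : Type*} [MeasurableSpace T] [NormedAddCommGroup E]

lemma integrable_norm_sub_sq {ρ : Measure T} [IsFiniteMeasure ρ] {F : T → E} {M : ℝ}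
    (hF : StronglyMeasurable F) (hM : ∀ t, ‖F t‖ ≤ M) (a : E) :
    Integrable (fun t => ‖a - F t‖ ^ 2) ρ := by
  refine Integrable.of_bound
    ((stronglyMeasurable_const.sub hF).norm.pow 2).aestronglyMeasurable ((‖a‖ + M) ^ 2)
    (ae_of_all _ fun t => ?_)
  rw [Real.norm_of_nonneg (by positivity)]
  have := (norm_sub_le a (F t)).trans (add_le_add_right (hM t) _)
  gcongr

/-- The logarithm, up to a constant, of the density of the exponential weights when the estimated
risk of `F t` is `‖f₀ - F t‖² + ℓ t`. -/
noncomputable def gibbsExponent (β : ℝ) (F : T → E) (f₀ : E) (ℓ pen : T → ℝ) (t : T) : ℝ :=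
  -(1 / β) * (‖f₀ - F t‖ ^ 2 + ℓ t + pen t)

/-- The exponent compared between a smoother `t` drawn from the exponential weights and a smoother
`u` drawn from a competitor; `pen` is paid by the first one and `q` by the second one. -/
noncomputable def pairExponent (β γ : ℝ) (F : T → E) (ℓ pen q : T → ℝ) (t u : T) : ℝ :=
  1 / β * (ℓ u - ℓ t - γ * ‖F u - F t‖ ^ 2 - q u - pen t)

variable {β γ : ℝ} {F : T → E} {f₀ : E} {ℓ pen q : T → ℝ}

lemma measurable_gibbsExponent (hF : StronglyMeasurable F) (hℓ : Measurable ℓ)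
    (hpen : Measurable pen) : Measurable (gibbsExponent β F f₀ ℓ pen) :=
  ((((stronglyMeasurable_const.sub hF).norm.pow 2).measurable.add hℓ).add hpen).const_mul _

lemma integrable_exp_gibbsExponent {π : Measure T} [IsFiniteMeasure π] (hβ : 0 < β)
    (hF : StronglyMeasurable F) (hℓ : Measurable ℓ) {L : ℝ} (hL : ∀ t, |ℓ t| ≤ L)
    (hpen : Measurable pen) (hpen0 : ∀ t, 0 ≤ pen t) :
    Integrable (fun t => Real.exp (gibbsExponent β F f₀ ℓ pen t)) π := by
  refine Integrable.of_bound
    (measurable_gibbsExponent hF hℓ hpen).exp.aestronglyMeasurable (Real.exp (1 / β * L))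
    (ae_of_all _ fun t => ?_)
  rw [Real.norm_of_nonneg (Real.exp_pos _).le, Real.exp_le_exp, gibbsExponent, neg_mul,
    ← mul_neg]
  refine mul_le_mul_of_nonneg_left ?_ (by positivity)
  have := abs_le.mp (hL t)
  nlinarith [hpen0 t, sq_nonneg ‖f₀ - F t‖]

variable [InnerProductSpace ℝ E] [CompleteSpace E]

/-- The bias–variance decomposition. -/
lemma integral_norm_sub_sq {ρ : Measure T} [IsProbabilityMeasure ρ] {F : T → E} {M : ℝ}
    (hF : StronglyMeasurable F) (hM : ∀ t, ‖F t‖ ≤ M) (a : E) :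
    ∫ t, ‖a - F t‖ ^ 2 ∂ρ =
      ‖a - ∫ t, F t ∂ρ‖ ^ 2 + ∫ t, ‖(∫ t, F t ∂ρ) - F t‖ ^ 2 ∂ρ := by
  have hFi : Integrable F ρ :=
    Integrable.of_bound hF.aestronglyMeasurable M (ae_of_all _ hM)
  set m := ∫ t, F t ∂ρ with hm
  have e : ∀ t, ‖a - F t‖ ^ 2 = ‖a - m‖ ^ 2 + 2 * ⟪a - m, m - F t⟫ + ‖m - F t‖ ^ 2 := by
    intro t
    rw [← norm_add_sq_real]; congr 2; abel
  have hi : Integrable (fun t => m - F t) ρ := (integrable_const m).sub hFi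
  have h0 : ∫ t, ⟪a - m, m - F t⟫ ∂ρ = 0 := by
    rw [integral_inner hi, integral_sub (integrable_const m) hFi]
    simp [← hm]
  have hi2 : Integrable (fun t => 2 * ⟪a - m, m - F t⟫) ρ := (hi.const_inner (𝕜 := ℝ) _).const_mul 2
  have hi3 : Integrable (fun t => ‖a - m‖ ^ 2 + 2 * ⟪a - m, m - F t⟫) ρ :=
    (integrable_const _).add hi2
  simp_rw [e]
  rw [integral_add hi3 (integrable_norm_sub_sq hF hM m), integral_add (integrable_const _) hi2,
    integral_const_mul 2, h0]
  simp

/-- Jensen's inequality under the exponential weights. The exponent of a pair minus the exponent of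
the weights no longer contains the penalty, and its mean is computed by the bias–variance
decomposition; the variance has the coefficient `1 - γ ≥ 0` and is dropped. -/
lemma exp_le_lintegral_pairExponent {π : Measure T} [IsProbabilityMeasure π] (hβ : 0 < β)
    (hγ : γ ≤ 1) (hF : StronglyMeasurable F) {M : ℝ} (hM : ∀ t, ‖F t‖ ≤ M)
    (hℓ : Measurable ℓ) {L : ℝ} (hL : ∀ t, |ℓ t| ≤ L)
    (hpen : Measurable pen) (hpen0 : ∀ t, 0 ≤ pen t) (u : T) :
    ENNReal.ofReal (Real.exp (1 / β *
        (‖f₀ - ∫ t, F t ∂(π.tilted (gibbsExponent β F f₀ ℓ pen))‖ ^ 2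
        - γ * ‖F u - ∫ t, F t ∂(π.tilted (gibbsExponent β F f₀ ℓ pen))‖ ^ 2 + ℓ u - q u)
        + Real.log (∫ t, Real.exp (gibbsExponent β F f₀ ℓ pen t) ∂π))) ≤
      ∫⁻ t, ENNReal.ofReal (Real.exp (pairExponent β γ F ℓ pen q t u)) ∂π := by
  set h := gibbsExponent β F f₀ ℓ pen with hh
  have hint : Integrable (fun t => Real.exp (h t)) π :=
    integrable_exp_gibbsExponent hβ hF hℓ hL hpen hpen0
  have : IsProbabilityMeasure (π.tilted h) := isProbabilityMeasure_tilted hint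
  have hpos : 0 < ∫ t, Real.exp (h t) ∂π := integral_exp_pos hint
  set ρ := π.tilted h
  set m := ∫ t, F t ∂ρ with hm
  -- the difference of the two exponents, which is bounded
  let k : T → ℝ := fun t => 1 / β * (‖f₀ - F t‖ ^ 2 - γ * ‖F u - F t‖ ^ 2 + (ℓ u - q u))
  have hFi := integrable_norm_sub_sq (ρ := ρ) hF hM f₀
  have hFu := (integrable_norm_sub_sq (ρ := ρ) hF hM (F u)).const_mul γ
  have hFiu : Integrable (fun t => ‖f₀ - F t‖ ^ 2 - γ * ‖F u - F t‖ ^ 2) ρ := hFi.sub hFu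
  have hk : Integrable k ρ := (hFiu.add (integrable_const _)).const_mul _
  have hhk : ∀ t, (h + k) t = pairExponent β γ F ℓ pen q t u := by
    intro t
    simp only [hh, k, Pi.add_apply, gibbsExponent, pairExponent]; ring
  have hkm : Measurable k :=
    ((((stronglyMeasurable_const.sub hF).norm.pow 2).measurable.sub
      (((stronglyMeasurable_const.sub hF).norm.pow 2).measurable.const_mul _)).add_const
        _).const_mul _
  have hkb : ∃ K, ∀ t, k t ≤ K := by
    refine ⟨1 / β * ((‖f₀‖ + M) ^ 2 + |γ| * (‖F u‖ + M) ^ 2 + (ℓ u - q u)), fun t => ?_⟩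
    refine mul_le_mul_of_nonneg_left ?_ (by positivity)
    have h1 : ‖f₀ - F t‖ ^ 2 ≤ (‖f₀‖ + M) ^ 2 := by
      have := (norm_sub_le f₀ (F t)).trans (add_le_add_right (hM t) _)
      gcongr
    have h2 : ‖F u - F t‖ ^ 2 ≤ (‖F u‖ + M) ^ 2 := by
      have := (norm_sub_le (F u) (F t)).trans (add_le_add_right (hM t) _)
      gcongr
    have h3 := mul_le_mul_of_nonneg_left h2 (abs_nonneg γ)
    have h4 := mul_le_mul_of_nonneg_right (neg_abs_le γ) (sq_nonneg ‖F u - F t‖)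
    linarith
  obtain ⟨K, hK⟩ := hkb
  have hek : Integrable (fun t => Real.exp (k t)) ρ := by
    refine Integrable.of_bound hkm.exp.aestronglyMeasurable (Real.exp K) (ae_of_all _ fun t => ?_)
    rw [Real.norm_of_nonneg (Real.exp_pos _).le]
    exact Real.exp_le_exp.mpr (hK t)
  have hkint : 1 / β * (‖f₀ - m‖ ^ 2 - γ * ‖F u - m‖ ^ 2 + ℓ u - q u) ≤ ∫ t, k t ∂ρ := by
    have e : ∫ t, k t ∂ρ = 1 / β * (∫ t, ‖f₀ - F t‖ ^ 2 ∂ρ - γ * ∫ t, ‖F u - F t‖ ^ 2 ∂ρ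
        + (ℓ u - q u)) := by
      simp only [k]
      rw [integral_const_mul, integral_add hFiu (integrable_const _), integral_sub hFi hFu,
        integral_const_mul γ]
      simp
    rw [e, integral_norm_sub_sq hF hM f₀, integral_norm_sub_sq hF hM (F u), ← hm]
    refine mul_le_mul_of_nonneg_left ?_ (by positivity)
    have : 0 ≤ ∫ t, ‖m - F t‖ ^ 2 ∂ρ := integral_nonneg fun _ => by positivity
    nlinarith
  have hjensen : Real.exp (∫ t, k t ∂ρ) ≤ ∫ t, Real.exp (k t) ∂ρ :=
    convexOn_exp.map_integral_le Real.continuous_exp.continuousOn isClosed_univ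
      (ae_of_all _ fun _ => Set.mem_univ _) hk hek
  have hξ : Integrable (fun t => Real.exp (pairExponent β γ F ℓ pen q t u)) π := by
    have := (integrable_tilted_iff hint _).mp hek
    refine this.congr (ae_of_all _ fun t => ?_)
    simp only [smul_eq_mul]
    rw [← Real.exp_add, ← hhk, Pi.add_apply]
  rw [← ofReal_integral_eq_lintegral_ofReal hξ (ae_of_all _ fun _ => (Real.exp_pos _).le)]
  refine ENNReal.ofReal_le_ofReal ?_
  rw [Real.exp_add, Real.exp_log hpos]
  have hexp := integral_exp_tilted (μ := π) h k
  simp_rw [hhk] at hexp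
  rw [eq_div_iff hpos.ne'] at hexp
  rw [← hexp]
  refine mul_le_mul_of_nonneg_right ?_ hpos.le
  exact (Real.exp_le_exp.mpr hkint).trans hjensen

open InformationTheory in
/-- The sum of two Donsker–Varadhan inequalities for `μ`, one for the exponent of the weights and
one for the Jensen lower bound of the pair exponent; the normalizing constant of the weights
cancels. -/
lemma pacBayes_bound {π : Measure T} [IsProbabilityMeasure π] (hβ : 0 < β)
    (hγ : γ ≤ 1) (hF : StronglyMeasurable F) {M : ℝ} (hM : ∀ t, ‖F t‖ ≤ M)
    (hℓ : Measurable ℓ) {L : ℝ} (hL : ∀ t, |ℓ t| ≤ L) (hq : Measurable q) {Q : ℝ}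
    (hQ : ∀ t, |q t| ≤ Q) (hpen : Measurable pen) (hpen0 : ∀ t, 0 ≤ pen t) {z : ℝ} (hz0 : 0 ≤ z)
    (hz : ∫⁻ u, ∫⁻ t, ENNReal.ofReal (Real.exp (pairExponent β γ F ℓ pen q t u)) ∂π ∂π
      ≤ ENNReal.ofReal z)
    {μ : Measure T} [IsProbabilityMeasure μ] (hKL : klDiv μ π ≠ ∞) (hμ : Integrable pen μ) :
    ‖f₀ - ∫ t, F t ∂(π.tilted (gibbsExponent β F f₀ ℓ pen))‖ ^ 2 ≤
      γ * ∫ u, ‖(∫ t, F t ∂(π.tilted (gibbsExponent β F f₀ ℓ pen))) - F u‖ ^ 2 ∂μ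
      + ∫ u, ‖f₀ - F u‖ ^ 2 ∂μ + ∫ u, (pen u + q u) ∂μ
      + β * (2 * (klDiv μ π).toReal + Real.log z) := by
  set h := gibbsExponent β F f₀ ℓ pen with hh
  have hint : Integrable (fun t => Real.exp (h t)) π :=
    integrable_exp_gibbsExponent hβ hF hℓ hL hpen hpen0
  set m := ∫ t, F t ∂(π.tilted h) with hm
  set c := Real.log (∫ t, Real.exp (h t) ∂π)
  let Ψ : T → ℝ := fun u => 1 / β * (‖f₀ - m‖ ^ 2 - γ * ‖F u - m‖ ^ 2 + ℓ u - q u) + c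
  have hqi : ∀ (ρ : Measure T) [IsProbabilityMeasure ρ], Integrable q ρ := fun ρ _ =>
    Integrable.of_bound hq.aestronglyMeasurable Q (ae_of_all _ hQ)
  have hℓi : ∀ (ρ : Measure T) [IsProbabilityMeasure ρ], Integrable ℓ ρ := fun ρ _ =>
    Integrable.of_bound hℓ.aestronglyMeasurable L (ae_of_all _ hL)
  have hmF : ∀ (ρ : Measure T) [IsProbabilityMeasure ρ],
      Integrable (fun u => ‖F u - m‖ ^ 2) ρ := fun ρ _ => by
    simp_rw [fun u => norm_sub_rev (F u) m]
    exact integrable_norm_sub_sq hF hM m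
  have hΨ : Integrable Ψ μ :=
    (((((integrable_const _).sub ((hmF μ).const_mul γ)).add (hℓi μ)).sub (hqi μ)).const_mul _).add
      (integrable_const _)
  have hΨm : Measurable Ψ :=
    ((((((hF.sub stronglyMeasurable_const).norm.pow 2).measurable.const_mul γ).const_sub _).add
      hℓ).sub hq).const_mul _ |>.add_const _
  have hlint : ∫⁻ u, ENNReal.ofReal (Real.exp (Ψ u)) ∂π ≤ ENNReal.ofReal z :=
    (lintegral_mono fun u =>
      exp_le_lintegral_pairExponent hβ hγ hF hM hℓ hL hpen hpen0 u).trans hz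
  have hΨe : Integrable (fun u => Real.exp (Ψ u)) π := by
    refine (lintegral_ofReal_ne_top_iff_integrable hΨm.exp.aestronglyMeasurable
      (ae_of_all _ fun _ => (Real.exp_pos _).le)).mp ?_
    exact ne_top_of_le_ne_top ENNReal.ofReal_ne_top hlint
  have hle : ∫ u, Real.exp (Ψ u) ∂π ≤ z := by
    rw [← ofReal_integral_eq_lintegral_ofReal hΨe (ae_of_all _ fun _ => (Real.exp_pos _).le)]
      at hlint
    exact (ENNReal.ofReal_le_ofReal_iff hz0).mp hlint
  have hhμ : Integrable h μ :=
    (((integrable_norm_sub_sq hF hM f₀).add (hℓi μ)).add hμ).const_mul _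
  have h1 := integral_le_klDiv_add_log hKL hΨ hΨe
  have h2 := integral_le_klDiv_add_log hKL hhμ hint
  have h3 := Real.log_le_log (integral_exp_pos hΨe) hle
  have hsum : ∫ u, (Ψ u + h u) ∂μ = c + 1 / β * (‖f₀ - m‖ ^ 2
      - (γ * ∫ u, ‖m - F u‖ ^ 2 ∂μ + ∫ u, ‖f₀ - F u‖ ^ 2 ∂μ + ∫ u, (pen u + q u) ∂μ)) := by
    have e : ∀ u, Ψ u + h u = c + 1 / β * (‖f₀ - m‖ ^ 2
        - (γ * ‖m - F u‖ ^ 2 + ‖f₀ - F u‖ ^ 2 + (pen u + q u))) := by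
      intro u
      simp only [Ψ, hh, gibbsExponent, norm_sub_rev m]; ring
    have i1 := (integrable_norm_sub_sq (ρ := μ) hF hM m).const_mul γ
    have i2 := integrable_norm_sub_sq (ρ := μ) hF hM f₀
    have i3 : Integrable (fun u => pen u + q u) μ := hμ.add (hqi μ)
    have i12 : Integrable (fun u => γ * ‖m - F u‖ ^ 2 + ‖f₀ - F u‖ ^ 2) μ := i1.add i2
    have i4 : Integrable (fun u => γ * ‖m - F u‖ ^ 2 + ‖f₀ - F u‖ ^ 2 + (pen u + q u)) μ :=
      i12.add i3
    have i5 : Integrable (fun u => 1 / β * (‖f₀ - m‖ ^ 2 -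
        (γ * ‖m - F u‖ ^ 2 + ‖f₀ - F u‖ ^ 2 + (pen u + q u)))) μ :=
      ((integrable_const _).sub i4).const_mul _
    simp_rw [e]
    rw [integral_add (integrable_const _) i5, integral_const_mul (1 / β),
      integral_sub (integrable_const _) i4, integral_add i12 i3, integral_add i1 i2,
      integral_const_mul γ]
    simp
  rw [integral_add hΨ hhμ] at hsum
  have h4 : 1 / β * (‖f₀ - m‖ ^ 2
      - (γ * ∫ u, ‖m - F u‖ ^ 2 ∂μ + ∫ u, ‖f₀ - F u‖ ^ 2 ∂μ + ∫ u, (pen u + q u) ∂μ)) ≤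
      2 * (klDiv μ π).toReal + Real.log z := by linarith
  rw [one_div, inv_mul_le_iff₀ hβ] at h4
  linarith

open InformationTheory in
/-- The aggregate appears on the right-hand side of `pacBayes_bound` with the coefficient `γ`;
moving it to the left costs the factors `1 + ε` and `1 + ε'`. -/
lemma pacBayes_oracle {π : Measure T} [IsProbabilityMeasure π] (hβ : 0 < β)
    (hγ0 : 0 ≤ γ) (hF : StronglyMeasurable F) {M : ℝ} (hM : ∀ t, ‖F t‖ ≤ M)
    (hℓ : Measurable ℓ) {L : ℝ} (hL : ∀ t, |ℓ t| ≤ L) (hq : Measurable q) {Q : ℝ}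
    (hQ : ∀ t, |q t| ≤ Q) (hpen : Measurable pen) (hpen0 : ∀ t, 0 ≤ pen t) {z : ℝ} (hz0 : 0 ≤ z)
    (hz : ∫⁻ u, ∫⁻ t, ENNReal.ofReal (Real.exp (pairExponent β γ F ℓ pen q t u)) ∂π ∂π
      ≤ ENNReal.ofReal z)
    {μ : Measure T} [IsProbabilityMeasure μ] (hKL : klDiv μ π ≠ ∞) (hμ : Integrable pen μ)
    {ν : ℝ} (hν : ν ∈ admissible γ) :
    ‖f₀ - ∫ t, F t ∂(π.tilted (gibbsExponent β F f₀ ℓ pen))‖ ^ 2 ≤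
      (1 + eps γ ν) * ∫ u, ‖f₀ - F u‖ ^ 2 ∂μ + (1 + eps' γ ν) * ∫ u, (pen u + q u) ∂μ
      + β * (1 + eps' γ ν) * (2 * (klDiv μ π).toReal + Real.log z) := by
  obtain ⟨hν0, hν1⟩ := hν
  have hγ1 : γ ≤ 1 := by nlinarith
  have key := pacBayes_bound (f₀ := f₀) hβ hγ1 hF hM hℓ hL hq hQ hpen hpen0 hz0 hz hKL hμ
  set m := ∫ t, F t ∂(π.tilted (gibbsExponent β F f₀ ℓ pen)) with hm
  have hpt : ∀ u, ‖m - F u‖ ^ 2 ≤ (1 + ν) * ‖f₀ - m‖ ^ 2 + (1 + 1 / ν) * ‖f₀ - F u‖ ^ 2 := by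
    intro u
    have h1 : ‖m - F u‖ ≤ ‖f₀ - m‖ + ‖f₀ - F u‖ := by
      calc ‖m - F u‖ = ‖(f₀ - F u) - (f₀ - m)‖ := by congr 1; abel
        _ ≤ _ := (norm_sub_le _ _).trans (by linarith)
    calc ‖m - F u‖ ^ 2 ≤ (‖f₀ - m‖ + ‖f₀ - F u‖) ^ 2 := by gcongr
      _ = (1 + ν) * ‖f₀ - m‖ ^ 2 + (1 + 1 / ν) * ‖f₀ - F u‖ ^ 2
          - 1 / ν * (ν * ‖f₀ - m‖ - ‖f₀ - F u‖) ^ 2 := by field_simp; ring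
      _ ≤ _ := by
        have : 0 ≤ 1 / ν * (ν * ‖f₀ - m‖ - ‖f₀ - F u‖) ^ 2 := by positivity
        linarith
  have i2 := integrable_norm_sub_sq (ρ := μ) hF hM f₀
  have hmF : ∫ u, ‖m - F u‖ ^ 2 ∂μ ≤
      (1 + ν) * ‖f₀ - m‖ ^ 2 + (1 + 1 / ν) * ∫ u, ‖f₀ - F u‖ ^ 2 ∂μ := by
    calc _ ≤ ∫ u, ((1 + ν) * ‖f₀ - m‖ ^ 2 + (1 + 1 / ν) * ‖f₀ - F u‖ ^ 2) ∂μ :=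
          integral_mono (integrable_norm_sub_sq hF hM m)
            ((integrable_const _).add (i2.const_mul _)) hpt
      _ = _ := by
          rw [integral_add (integrable_const _) (i2.const_mul _),
            integral_const_mul (1 + 1 / ν)]
          simp
  have hd : 0 < 1 - (1 + ν) * γ := by linarith
  have e1 : 1 + eps γ ν = (1 + γ * (1 + 1 / ν)) / (1 - (1 + ν) * γ) := by
    simp only [eps]; field_simp; ring
  have e2 : 1 + eps' γ ν = 1 / (1 - (1 + ν) * γ) := by simp only [eps']; ring
  rw [e1, e2]
  have hγm := mul_le_mul_of_nonneg_left hmF hγ0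
  have hfin : (1 - (1 + ν) * γ) * ‖f₀ - m‖ ^ 2 ≤ (1 + γ * (1 + 1 / ν)) * ∫ u, ‖f₀ - F u‖ ^ 2 ∂μ +
      ∫ u, (pen u + q u) ∂μ + β * (2 * (klDiv μ π).toReal + Real.log z) := by linarith
  rw [← le_div_iff₀' hd] at hfin
  refine hfin.trans (le_of_eq ?_)
  field_simp

end PACBayes

/-! ### Measurability -/

lemma measurable_op_apply {T : Type*} [MeasurableSpace T] {n : ℕ}
    {P : T → Matrix (Fin n) (Fin n) ℝ} (hPm : ∀ i j, Measurable fun t => P t i j)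
    {X : Type*} [MeasurableSpace X] {a : X → T} {y : X → EuclideanSpace ℝ (Fin n)}
    (ha : Measurable a) (hy : Measurable y) : Measurable fun x => op (P (a x)) (y x) := by
  have h : Measurable fun x => (op (P (a x)) (y x)).ofLp := by
    refine measurable_pi_iff.mpr fun i => ?_
    simp only [Matrix.ofLp_toEuclideanCLM, Matrix.mulVec, dotProduct]
    refine Finset.measurable_sum _ fun j _ => ((hPm i j).comp ha).mul ?_
    fun_prop
  exact (MeasurableEquiv.toLp 2 (Fin n → ℝ)).measurable.comp h

lemma measurable_trace {T : Type*} [MeasurableSpace T] {n : ℕ}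
    {P : T → Matrix (Fin n) (Fin n) ℝ} (hPm : ∀ i j, Measurable fun t => P t i j) :
    Measurable fun t => (P t).trace := by
  simp only [Matrix.trace, Matrix.diag]
  exact Finset.measurable_sum _ fun i _ => hPm i i

lemma measurable_trace_sq {T : Type*} [MeasurableSpace T] {n : ℕ}
    {P : T → Matrix (Fin n) (Fin n) ℝ} (hPm : ∀ i j, Measurable fun t => P t i j) :
    Measurable fun t => (P t ^ 2).trace := by
  simp only [pow_two, Matrix.trace, Matrix.diag, Matrix.mul_apply]
  exact Finset.measurable_sum _ fun i _ => Finset.measurable_sum _ fun j _ =>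
    (hPm i j).mul (hPm j i)

/-- A tilted mean depends measurably on a parameter: it is a quotient of two integrals against a
measure that does not depend on the parameter. -/
lemma stronglyMeasurable_integral_tilted {Ω T E : Type*} [MeasurableSpace Ω] [MeasurableSpace T]
    [NormedAddCommGroup E] [NormedSpace ℝ E] {π : Measure T} [SFinite π]
    {H : Ω → T → ℝ} (hH : Measurable (Function.uncurry H)) {G : Ω → T → E}
    (hG : StronglyMeasurable (Function.uncurry G)) :
    StronglyMeasurable fun ω => ∫ t, G ω t ∂(π.tilted (H ω)) := by
  simp_rw [integral_tilted]
  have hden : StronglyMeasurable fun ω => ∫ t, Real.exp (H ω t) ∂π :=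
    hH.exp.stronglyMeasurable.integral_prod_right
  refine StronglyMeasurable.integral_prod_right (f := fun ω t =>
    (Real.exp (H ω t) / ∫ t, Real.exp (H ω t) ∂π) • G ω t) ?_
  exact (hH.exp.div (hden.measurable.comp measurable_fst)).stronglyMeasurable.smul hG

/-! ### The evidence in the regression model -/

section Model

variable {n : ℕ} {T : Type*}

/-- The difference between Stein's estimate of the risk of `P t Y` and its loss `‖f₀ - P t Y‖²`,
as a function of the noise `w = Y - f₀`. -/
noncomputable def steinNoise (σ2 : ℝ) (P : T → Matrix (Fin n) (Fin n) ℝ)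
    (f₀ w : EuclideanSpace ℝ (Fin n)) (t : T) : ℝ :=
  2 * ⟪w, f₀ - op (P t) (f₀ + w)⟫ + ‖w‖ ^ 2 - n * σ2 + 2 * σ2 * (P t).trace

lemma steinRisk_eq (σ2 : ℝ) (P : T → Matrix (Fin n) (Fin n) ℝ)
    (f₀ w : EuclideanSpace ℝ (Fin n)) (t : T) :
    steinRisk σ2 (P t) (f₀ + w) =
      ‖f₀ - op (P t) (f₀ + w)‖ ^ 2 + steinNoise σ2 P f₀ w t := by
  have h : f₀ + w - op (P t) (f₀ + w) = w + (f₀ - op (P t) (f₀ + w)) := by abel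
  rw [steinRisk, h, norm_add_sq_real, steinNoise]
  ring

/-- The exponential of the pair exponent of the smoothers, with values in `ℝ≥0∞`, as a function of
the noise `w`. -/
noncomputable def pairWeight (σ2 V β δ C : ℝ) (P : T → Matrix (Fin n) (Fin n) ℝ) (pen : T → ℝ)
    (f₀ w : EuclideanSpace ℝ (Fin n)) (t u : T) : ℝ≥0∞ :=
  ENNReal.ofReal (Real.exp (pairExponent β (gam σ2 V β δ)
    (fun t => op (P t) (f₀ + w)) (steinNoise σ2 P f₀ w) pen
    (fun t => price σ2 V β δ C (P t)) t u))

/-- The integral of the pair weight over two independent draws from the prior. Its expectation is at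
most one, and its logarithm is the only random term of the oracle inequality besides the loss of the
competitor. -/
noncomputable def evidence [MeasurableSpace T] (σ2 V β δ C : ℝ)
    (P : T → Matrix (Fin n) (Fin n) ℝ) (pen : T → ℝ) (prior : Measure T)
    (f₀ w : EuclideanSpace ℝ (Fin n)) : ℝ≥0∞ :=
  ∫⁻ u, ∫⁻ t, pairWeight σ2 V β δ C P pen f₀ w t u ∂prior ∂prior

lemma pairExponent_eq (σ2 β γ : ℝ) (P : T → Matrix (Fin n) (Fin n) ℝ) (pen q : T → ℝ)
    (f₀ w : EuclideanSpace ℝ (Fin n)) (t u : T) :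
    pairExponent β γ (fun t => op (P t) (f₀ + w)) (steinNoise σ2 P f₀ w) pen q t u =
      1 / β * (2 * ⟪w, op (P t) (f₀ + w) - op (P u) (f₀ + w)⟫ - 2 * σ2 * (P t).trace
        + 2 * σ2 * (P u).trace - γ * ‖op (P t) (f₀ + w) - op (P u) (f₀ + w)‖ ^ 2
        - q u - pen t) := by
  simp only [pairExponent, steinNoise, inner_sub_right, norm_sub_rev (op (P u) (f₀ + w))]
  ring

lemma gibbs_eq_tilted [MeasurableSpace T] (σ2 β : ℝ) (P : T → Matrix (Fin n) (Fin n) ℝ)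
    (pen : T → ℝ) (prior : Measure T) (f₀ w : EuclideanSpace ℝ (Fin n)) :
    gibbs σ2 β P pen prior (f₀ + w) = prior.tilted
      (gibbsExponent β (fun t => op (P t) (f₀ + w)) f₀ (steinNoise σ2 P f₀ w) pen) := by
  simp only [gibbs, steinRisk_eq]
  rfl

lemma abs_steinNoise_le {σ2 V : ℝ} {P : T → Matrix (Fin n) (Fin n) ℝ} (hσ : 0 < σ2)
    (hP : ∀ t, (P t).PosSemidef) (hPV : ∀ t, ‖op (P t)‖ ≤ V)
    (f₀ w : EuclideanSpace ℝ (Fin n)) (t : T) :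
    |steinNoise σ2 P f₀ w t| ≤ 2 * (‖w‖ * (‖f₀‖ + V * ‖f₀ + w‖)) + ‖w‖ ^ 2 + n * σ2
      + 2 * σ2 * (n * V) := by
  have h1 : |⟪w, f₀ - op (P t) (f₀ + w)⟫| ≤ ‖w‖ * (‖f₀‖ + V * ‖f₀ + w‖) := by
    refine (abs_real_inner_le_norm _ _).trans ?_
    gcongr
    exact (norm_sub_le _ _).trans (add_le_add_right ((op (P t)).le_of_opNorm_le (hPV t) _) _)
  have h2 := (hP t).trace_nonneg
  have h3 := mul_le_mul_of_nonneg_left (trace_le_of_norm_op_le (hP t).1 (hPV t)) hσ.le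
  have h4 : 0 ≤ (n : ℝ) * σ2 := by positivity
  have h5 := mul_nonneg hσ.le h2
  obtain ⟨h6, h7⟩ := abs_le.mp h1
  have h8 := sq_nonneg ‖w‖
  rw [steinNoise, abs_le]
  constructor <;> linarith

lemma price_nonneg {σ2 V β δ C : ℝ} {A : Matrix (Fin n) (Fin n) ℝ} (hσ : 0 < σ2)
    (hβ : 4 * σ2 * V < β) (hδ : δ ∈ Set.Icc (0 : ℝ) 1) (hA : A.PosSemidef) :
    0 ≤ price σ2 V β δ C A := by
  have h1 := hA.trace_nonneg
  have h2 := trace_sq_nonneg hA.1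
  have h3 : 0 ≤ 1 - δ := by linarith [hδ.2]
  have h4 : 0 < β - 4 * σ2 * V := by linarith
  unfold price
  positivity

lemma penBound_nonneg {σ2 V β δ C : ℝ} {A : Matrix (Fin n) (Fin n) ℝ} (hσ : 0 < σ2)
    (hβ : 4 * σ2 * V < β) (hδ : δ ∈ Set.Icc (0 : ℝ) 1) (hA : A.PosSemidef) :
    0 ≤ penBound σ2 V β δ C A := by
  have h2 := trace_sq_nonneg hA.1
  have h3 : 0 ≤ 1 - δ := by linarith [hδ.2]
  have h4 : 0 < β - 4 * σ2 * V := by linarith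
  unfold penBound
  positivity

lemma exists_price_le {σ2 V β δ C : ℝ} {P : T → Matrix (Fin n) (Fin n) ℝ} (hσ : 0 < σ2)
    (hβ : 4 * σ2 * V < β) (hδ : δ ∈ Set.Icc (0 : ℝ) 1)
    (hP : ∀ t, (P t).PosSemidef) (hPV : ∀ t, ‖op (P t)‖ ≤ V) :
    ∃ Q, ∀ t, |price σ2 V β δ C (P t)| ≤ Q := by
  refine ⟨2 * σ2 * (n * V +
    2 * σ2 * (1 - δ) * (1 + 2 * gam σ2 V β δ * V) ^ 2 / (β - 4 * σ2 * V)
      * (C ^ 2 / σ2) * (n * V ^ 2)), fun t => ?_⟩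
  rw [abs_of_nonneg (price_nonneg hσ hβ hδ (hP t)), price]
  have h1 := trace_le_of_norm_op_le (hP t).1 (hPV t)
  have h2 := trace_sq_le_of_norm_op_le (hP t) (hPV t)
  have h3 : 0 ≤ 1 - δ := by linarith [hδ.2]
  have h4 : 0 < β - 4 * σ2 * V := by linarith
  gcongr

variable [MeasurableSpace T]

lemma measurable_price {σ2 V β δ C : ℝ} {P : T → Matrix (Fin n) (Fin n) ℝ}
    (hPm : ∀ i j, Measurable fun t => P t i j) :
    Measurable fun t => price σ2 V β δ C (P t) :=
  ((measurable_trace hPm).add ((measurable_trace_sq hPm).const_mul _)).const_mul _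

lemma measurable_steinNoise {σ2 : ℝ} {P : T → Matrix (Fin n) (Fin n) ℝ}
    (hPm : ∀ i j, Measurable fun t => P t i j) (f₀ : EuclideanSpace ℝ (Fin n))
    {X : Type*} [MeasurableSpace X] {a : X → T} {w : X → EuclideanSpace ℝ (Fin n)}
    (ha : Measurable a) (hw : Measurable w) :
    Measurable fun x => steinNoise σ2 P f₀ (w x) (a x) := by
  have h1 : Measurable fun x => op (P (a x)) (f₀ + w x) :=
    measurable_op_apply hPm ha (hw.const_add f₀)
  have h2 : Measurable fun x => (P (a x)).trace := (measurable_trace hPm).comp ha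
  unfold steinNoise
  exact ((((hw.inner (h1.const_sub f₀)).const_mul 2).add
    (hw.norm.pow_const 2)).sub_const _).add (h2.const_mul _)

lemma measurable_pairWeight {σ2 V β δ C : ℝ} {P : T → Matrix (Fin n) (Fin n) ℝ}
    (hPm : ∀ i j, Measurable fun t => P t i j) {pen : T → ℝ} (hpenm : Measurable pen)
    (f₀ : EuclideanSpace ℝ (Fin n)) {X : Type*} [MeasurableSpace X] {a b : X → T}
    {w : X → EuclideanSpace ℝ (Fin n)} (hw : Measurable w) (ha : Measurable a)
    (hb : Measurable b) :
    Measurable fun x => pairWeight σ2 V β δ C P pen f₀ (w x) (a x) (b x) := by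
  have h1 := measurable_op_apply hPm ha (hw.const_add f₀)
  have h2 := measurable_op_apply hPm hb (hw.const_add f₀)
  have h3 := measurable_steinNoise (σ2 := σ2) hPm f₀ ha hw
  have h4 := measurable_steinNoise (σ2 := σ2) hPm f₀ hb hw
  have h5 := (measurable_price (σ2 := σ2) (V := V) (β := β) (δ := δ) (C := C) hPm).comp hb
  unfold pairWeight pairExponent
  exact ((((((h4.sub h3).sub (((h2.sub h1).norm.pow_const 2).const_mul _)).sub h5).sub
    (hpenm.comp ha)).const_mul _).exp).ennreal_ofReal

lemma measurable_lintegral_pairWeight {σ2 V β δ C : ℝ} {P : T → Matrix (Fin n) (Fin n) ℝ}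
    (hPm : ∀ i j, Measurable fun t => P t i j) {pen : T → ℝ} (hpenm : Measurable pen)
    (prior : Measure T) [SFinite prior] (f₀ : EuclideanSpace ℝ (Fin n)) {X : Type*}
    [MeasurableSpace X] {b : X → T} {w : X → EuclideanSpace ℝ (Fin n)} (hw : Measurable w)
    (hb : Measurable b) :
    Measurable fun x => ∫⁻ t, pairWeight σ2 V β δ C P pen f₀ (w x) t (b x) ∂prior := by
  have h : Measurable fun p : X × T => pairWeight σ2 V β δ C P pen f₀ (w p.1) p.2 (b p.1) :=
    measurable_pairWeight hPm hpenm f₀ (hw.comp measurable_fst) measurable_snd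
      (hb.comp measurable_fst)
  exact h.lintegral_prod_right'

lemma measurable_evidence {σ2 V β δ C : ℝ} {P : T → Matrix (Fin n) (Fin n) ℝ}
    (hPm : ∀ i j, Measurable fun t => P t i j) {pen : T → ℝ} (hpenm : Measurable pen)
    (prior : Measure T) [SFinite prior] (f₀ : EuclideanSpace ℝ (Fin n)) :
    Measurable (evidence σ2 V β δ C P pen prior f₀) := by
  have h := measurable_lintegral_pairWeight (σ2 := σ2) (V := V) (β := β) (δ := δ) (C := C)
    hPm hpenm prior f₀ (measurable_fst (α := EuclideanSpace ℝ (Fin n)) (β := T)) measurable_snd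
  exact h.lintegral_prod_right'

lemma evidence_pos {σ2 V β δ C : ℝ} {P : T → Matrix (Fin n) (Fin n) ℝ}
    (hPm : ∀ i j, Measurable fun t => P t i j) {pen : T → ℝ} (hpenm : Measurable pen)
    (prior : Measure T) [IsProbabilityMeasure prior] (f₀ w : EuclideanSpace ℝ (Fin n)) :
    0 < evidence σ2 V β δ C P pen prior f₀ w := by
  have hm1 : ∀ u, Measurable fun t => pairWeight σ2 V β δ C P pen f₀ w t u := fun u =>
    measurable_pairWeight hPm hpenm f₀ measurable_const measurable_id measurable_const
  have hpos : ∀ t u, pairWeight σ2 V β δ C P pen f₀ w t u ≠ 0 := fun t u =>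
    (ENNReal.ofReal_pos.mpr (Real.exp_pos _)).ne'
  have hin : ∀ u, 0 < ∫⁻ t, pairWeight σ2 V β δ C P pen f₀ w t u ∂prior := by
    intro u
    rw [lintegral_pos_iff_support (hm1 u), Function.support_eq_univ fun t => hpos t u]
    simp
  have hm2 : Measurable fun u => ∫⁻ t, pairWeight σ2 V β δ C P pen f₀ w t u ∂prior :=
    measurable_lintegral_pairWeight hPm hpenm prior f₀ measurable_const measurable_id
  rw [evidence, lintegral_pos_iff_support hm2, Function.support_eq_univ fun u => (hin u).ne']
  simp

lemma lintegral_evidence_le_one {Ω : Type*} [MeasurableSpace Ω] {Pr : Measure Ω}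
    [IsProbabilityMeasure Pr] {W : Ω → EuclideanSpace ℝ (Fin n)} {σ2 V β δ : ℝ}
    (hWm : Measurable W) (hσ : 0 < σ2) (hW : IsCenteredSubGaussian W σ2 Pr)
    {P : T → Matrix (Fin n) (Fin n) ℝ} (hPm : ∀ i j, Measurable fun t => P t i j)
    (hP : ∀ t, (P t).PosSemidef) (hV : 0 < V) (hPV : ∀ t, ‖op (P t)‖ ≤ V)
    (prior : Measure T) [IsProbabilityMeasure prior] (hβ : 4 * σ2 * V < β)
    {pen : T → ℝ} (hpenm : Measurable pen) (hδ : δ ∈ Set.Icc (0 : ℝ) 1)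
    (hβδ : 4 * σ2 * V * (1 + 4 * δ) ≤ β) (f₀ : EuclideanSpace ℝ (Fin n))
    (hpen : ∀ t, penBound σ2 V β δ (tildeNorm P f₀) (P t) ≤ pen t) :
    ∫⁻ ω, evidence σ2 V β δ (tildeNorm P f₀) P pen prior f₀ (W ω) ∂Pr ≤ 1 := by
  have hm1 : ∀ u, Measurable fun p : Ω × T =>
      pairWeight σ2 V β δ (tildeNorm P f₀) P pen f₀ (W p.1) p.2 u := fun u =>
    measurable_pairWeight hPm hpenm f₀ (hWm.comp measurable_fst) measurable_snd measurable_const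
  have hm2 : Measurable fun p : Ω × T =>
      ∫⁻ t, pairWeight σ2 V β δ (tildeNorm P f₀) P pen f₀ (W p.1) t p.2 ∂prior :=
    measurable_lintegral_pairWeight hPm hpenm prior f₀ (hWm.comp measurable_fst) measurable_snd
  have hone : ∀ t u,
      ∫⁻ ω, pairWeight σ2 V β δ (tildeNorm P f₀) P pen f₀ (W ω) t u ∂Pr ≤ 1 := by
    intro t u
    simp_rw [pairWeight, pairExponent_eq]
    exact lintegral_exp_pair_le_one hWm hσ hW (hP t) (hP u) hV (hPV t) (hPV u) hβ hδ
      hβδ f₀ (norm_op_sq_le_tildeNorm (fun t => (hP t).1) f₀ t)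
      (norm_op_sq_le_tildeNorm (fun t => (hP t).1) f₀ u) (hpen t)
  unfold evidence
  rw [lintegral_lintegral_swap hm2.aemeasurable]
  calc _ ≤ ∫⁻ _u : T, 1 ∂prior := by
        refine lintegral_mono fun u => ?_
        rw [lintegral_lintegral_swap (hm1 u).aemeasurable]
        exact (lintegral_mono fun t => hone t u).trans (by simp)
    _ = 1 := by simp

lemma one_add_eps'_pos {γ ν : ℝ} (hν : ν ∈ admissible γ) : 0 < 1 + eps' γ ν := by
  have : 0 < 1 - (1 + ν) * γ := by linarith [hν.2]
  have e : 1 + eps' γ ν = 1 / (1 - (1 + ν) * γ) := by simp only [eps']; ring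
  rw [e]; positivity

lemma eps_nonneg {γ ν : ℝ} (hγ : 0 ≤ γ) (hν : ν ∈ admissible γ) : 0 ≤ eps γ ν := by
  have : 0 < 1 - (1 + ν) * γ := by linarith [hν.2]
  have := hν.1
  unfold eps; positivity

open InformationTheory in
/-- The oracle inequality at a fixed value of the noise, in `ℝ≥0∞`. The constant `d` on the left
serves to bound `log z` by a nonnegative quantity: `d = 0` and `z ≥ 1` for the bound in
probability, `d = 1` and `c = z` for the bound in expectation. -/
lemma oracle_of_evidence_le {σ2 V β δ : ℝ} (hσ : 0 < σ2)
    {P : T → Matrix (Fin n) (Fin n) ℝ} (hPm : ∀ i j, Measurable fun t => P t i j)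
    (hP : ∀ t, (P t).PosSemidef) (hV : 0 < V) (hPV : ∀ t, ‖op (P t)‖ ≤ V)
    {prior : Measure T} [IsProbabilityMeasure prior] (hβ : 4 * σ2 * V < β)
    {pen : T → ℝ} (hpenm : Measurable pen) (hδ : δ ∈ Set.Icc (0 : ℝ) 1)
    (hβδ : 4 * σ2 * V * (1 + 4 * δ) ≤ β) {f₀ : EuclideanSpace ℝ (Fin n)} {C : ℝ}
    (hpen : ∀ t, penBound σ2 V β δ C (P t) ≤ pen t)
    {w : EuclideanSpace ℝ (Fin n)} {z c d : ℝ} (hz0 : 0 ≤ z) (hc : 0 ≤ c)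
    (hd : 0 ≤ d) (hz : evidence σ2 V β δ C P pen prior f₀ w ≤ ENNReal.ofReal z)
    (hcd : Real.log z + d ≤ c) {ν : ℝ} (hν : ν ∈ admissible (gam σ2 V β δ))
    (μ : Measure T) [IsProbabilityMeasure μ] :
    ENNReal.ofReal (‖f₀ - ewa σ2 β P pen prior (f₀ + w)‖ ^ 2)
        + ENNReal.ofReal (β * (1 + eps' (gam σ2 V β δ) ν)) * ENNReal.ofReal d ≤
      ENNReal.ofReal (1 + eps (gam σ2 V β δ) ν) *
          ∫⁻ t, ENNReal.ofReal (‖f₀ - op (P t) (f₀ + w)‖ ^ 2) ∂μ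
        + ENNReal.ofReal (1 + eps' (gam σ2 V β δ) ν) *
          ∫⁻ t, ENNReal.ofReal (pen t + price σ2 V β δ C (P t)) ∂μ
        + ENNReal.ofReal (β * (1 + eps' (gam σ2 V β δ) ν)) *
          (2 * klDiv μ prior + ENNReal.ofReal c) := by
  have hβ0 : 0 < β := lt_of_le_of_lt (by positivity) hβ
  have hγ0 : 0 ≤ gam σ2 V β δ := (gam_nonneg_and_eq hσ hV hβ hδ.1 hβδ).1
  have he' := one_add_eps'_pos hν
  have he := eps_nonneg hγ0 hν
  have hb' : 0 < β * (1 + eps' (gam σ2 V β δ) ν) := by positivity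
  -- the right-hand side is infinite unless the divergence and the penalty are finite
  by_cases hKL : klDiv μ prior = ∞
  · refine le_of_le_of_eq le_top ?_
    rw [hKL, ENNReal.mul_top two_ne_zero, top_add,
      ENNReal.mul_top (ENNReal.ofReal_pos.mpr hb').ne', add_top]
  have hpen0 : ∀ t, 0 ≤ pen t := fun t => (penBound_nonneg hσ hβ hδ (hP t)).trans (hpen t)
  have hq0 : ∀ t, 0 ≤ price σ2 V β δ C (P t) := fun t => price_nonneg hσ hβ hδ (hP t)
  have hqm : Measurable fun t => price σ2 V β δ C (P t) := measurable_price hPm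
  have hpq0 : ∀ t, 0 ≤ pen t + price σ2 V β δ C (P t) := fun t => add_nonneg (hpen0 t) (hq0 t)
  by_cases hpq : ∫⁻ t, ENNReal.ofReal (pen t + price σ2 V β δ C (P t)) ∂μ = ∞
  · refine le_of_le_of_eq le_top ?_
    rw [hpq, ENNReal.mul_top (ENNReal.ofReal_pos.mpr he').ne', add_top, top_add]
  have hpqi : Integrable (fun t => pen t + price σ2 V β δ C (P t)) μ :=
    (lintegral_ofReal_ne_top_iff_integrable (hpenm.add hqm).aestronglyMeasurable
      (ae_of_all _ hpq0)).mp hpq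
  have hpeni : Integrable pen μ := by
    refine hpqi.mono hpenm.aestronglyMeasurable (ae_of_all _ fun t => ?_)
    rw [Real.norm_of_nonneg (hpen0 t), Real.norm_of_nonneg (hpq0 t)]
    exact le_add_of_nonneg_right (hq0 t)
  obtain ⟨Q, hQ⟩ := exists_price_le (C := C) hσ hβ hδ hP hPV
  have hF : StronglyMeasurable fun t => op (P t) (f₀ + w) :=
    (measurable_op_apply hPm measurable_id measurable_const).stronglyMeasurable
  have hM : ∀ t, ‖op (P t) (f₀ + w)‖ ≤ V * ‖f₀ + w‖ := fun t =>
    (op (P t)).le_of_opNorm_le (hPV t) _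
  have hℓ : Measurable (steinNoise σ2 P f₀ w) :=
    measurable_steinNoise hPm f₀ measurable_id measurable_const
  have key := pacBayes_oracle (f₀ := f₀) hβ0 hγ0 hF hM hℓ (abs_steinNoise_le hσ hP hPV f₀ w)
    hqm hQ hpenm hpen0 hz0 hz hKL hpeni hν
  rw [← gibbs_eq_tilted] at key
  have key2 : ‖f₀ - ewa σ2 β P pen prior (f₀ + w)‖ ^ 2
      + β * (1 + eps' (gam σ2 V β δ) ν) * d ≤
      (1 + eps (gam σ2 V β δ) ν) * ∫ u, ‖f₀ - op (P u) (f₀ + w)‖ ^ 2 ∂μ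
      + (1 + eps' (gam σ2 V β δ) ν) * ∫ u, (pen u + price σ2 V β δ C (P u)) ∂μ
      + β * (1 + eps' (gam σ2 V β δ) ν) * (2 * (klDiv μ prior).toReal + c) := by
    have := mul_le_mul_of_nonneg_left hcd hb'.le
    unfold ewa
    linarith
  rw [← ofReal_integral_eq_lintegral_ofReal (integrable_norm_sub_sq hF hM f₀)
      (ae_of_all _ fun _ => sq_nonneg _),
    ← ofReal_integral_eq_lintegral_ofReal hpqi (ae_of_all _ hpq0),
    ← ENNReal.ofReal_toReal hKL]
  have i1 : 0 ≤ ∫ u, ‖f₀ - op (P u) (f₀ + w)‖ ^ 2 ∂μ := integral_nonneg fun _ => sq_nonneg _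
  have i2 : 0 ≤ ∫ u, (pen u + price σ2 V β δ C (P u)) ∂μ := integral_nonneg hpq0
  have i3 : 0 ≤ (klDiv μ prior).toReal := ENNReal.toReal_nonneg
  have hK2 : 2 * ENNReal.ofReal (klDiv μ prior).toReal =
      ENNReal.ofReal (2 * (klDiv μ prior).toReal) := by
    rw [ENNReal.ofReal_mul zero_le_two]; simp
  rw [hK2, ← ENNReal.ofReal_mul hb'.le, ← ENNReal.ofReal_mul (by linarith),
    ← ENNReal.ofReal_mul he'.le,
    ← ENNReal.ofReal_add (by positivity) hc, ← ENNReal.ofReal_mul hb'.le,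
    ← ENNReal.ofReal_add (by positivity) (by positivity),
    ← ENNReal.ofReal_add (by positivity) (by positivity),
    ← ENNReal.ofReal_add (by positivity) (by positivity)]
  exact ENNReal.ofReal_le_ofReal key2

end Model

end EWA

/-! ### The oracle inequalities -/

theorem mainTheorem1 {n : ℕ} {Ω T : Type*} [MeasurableSpace Ω] [MeasurableSpace T]
    (Pr : Measure Ω) [IsProbabilityMeasure Pr]
    -- the signal and the noise
    (f₀ : EuclideanSpace ℝ (Fin n)) (W : Ω → EuclideanSpace ℝ (Fin n)) (hWm : Measurable W)
    (σ2 : ℝ) (hσ : 0 < σ2) (hW : EWA.IsCenteredSubGaussian W σ2 Pr)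
    -- the smoothers
    (P : T → Matrix (Fin n) (Fin n) ℝ) (hPm : ∀ i j, Measurable fun t => P t i j)
    (hP : ∀ t, (P t).PosSemidef) (V : ℝ) (hV : 0 < V) (hPV : ∀ t, ‖EWA.op (P t)‖ ≤ V)
    -- the prior, the temperature and the penalty
    (prior : Measure T) [IsProbabilityMeasure prior]
    (β : ℝ) (hβ : 4 * σ2 * V < β) (pen : T → ℝ) (hpenm : Measurable pen)
    (δ : ℝ) (hδ : δ ∈ Set.Icc (0 : ℝ) 1) (hβδ : 4 * σ2 * V * (1 + 4 * δ) ≤ β)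
    (hpen : ∀ t, EWA.penBound σ2 V β δ (EWA.tildeNorm P f₀) (P t) ≤ pen t) :
    -- the aggregate is well defined
    ((∀ y : EuclideanSpace ℝ (Fin n), IsProbabilityMeasure (EWA.gibbs σ2 β P pen prior y) ∧
        Integrable (fun t => EWA.op (P t) y) (EWA.gibbs σ2 β P pen prior y)) ∧
      Measurable fun ω => EWA.ewa σ2 β P pen prior (f₀ + W ω)) ∧
    -- the oracle inequality in probability
    (∀ η : ℝ, η ∈ Set.Ioc (0 : ℝ) 1 →
      ∃ A : Set Ω, MeasurableSet A ∧ ENNReal.ofReal (1 - η) ≤ Pr A ∧ ∀ ω ∈ A,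
        ENNReal.ofReal (‖f₀ - EWA.ewa σ2 β P pen prior (f₀ + W ω)‖ ^ 2) ≤
          ⨅ ν ∈ EWA.admissible (EWA.gam σ2 V β δ), ⨅ μ : ProbabilityMeasure T,
            (ENNReal.ofReal (1 + EWA.eps (EWA.gam σ2 V β δ) ν) *
                ∫⁻ t, ENNReal.ofReal (‖f₀ - EWA.op (P t) (f₀ + W ω)‖ ^ 2) ∂(μ : Measure T)
              + ENNReal.ofReal (1 + EWA.eps' (EWA.gam σ2 V β δ) ν) *
                ∫⁻ t, ENNReal.ofReal (pen t + EWA.price σ2 V β δ (EWA.tildeNorm P f₀) (P t))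
                  ∂(μ : Measure T)
              + ENNReal.ofReal (β * (1 + EWA.eps' (EWA.gam σ2 V β δ) ν)) *
                (2 * InformationTheory.klDiv (μ : Measure T) prior
                  + ENNReal.ofReal (Real.log (1 / η))))) ∧
    -- the oracle inequality in expectation
    ∫⁻ ω, ENNReal.ofReal (‖f₀ - EWA.ewa σ2 β P pen prior (f₀ + W ω)‖ ^ 2) ∂Pr ≤
      ⨅ ν ∈ EWA.admissible (EWA.gam σ2 V β δ), ⨅ μ : ProbabilityMeasure T,
        (ENNReal.ofReal (1 + EWA.eps (EWA.gam σ2 V β δ) ν) *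
            ∫⁻ t, (∫⁻ ω, ENNReal.ofReal (‖f₀ - EWA.op (P t) (f₀ + W ω)‖ ^ 2) ∂Pr) ∂(μ : Measure T)
          + ENNReal.ofReal (1 + EWA.eps' (EWA.gam σ2 V β δ) ν) *
            ∫⁻ t, ENNReal.ofReal (pen t + EWA.price σ2 V β δ (EWA.tildeNorm P f₀) (P t))
              ∂(μ : Measure T)
          + ENNReal.ofReal (2 * β * (1 + EWA.eps' (EWA.gam σ2 V β δ) ν)) *
            InformationTheory.klDiv (μ : Measure T) prior) := by
  have hβ0 : 0 < β := lt_of_le_of_lt (by positivity) hβ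
  have hpen0 : ∀ t, 0 ≤ pen t := fun t =>
    (EWA.penBound_nonneg hσ hβ hδ (hP t)).trans (hpen t)
  have hFm : Measurable fun p : Ω × T => EWA.op (P p.2) (f₀ + W p.1) :=
    EWA.measurable_op_apply hPm measurable_snd ((hWm.comp measurable_fst).const_add f₀)
  have hRm : Measurable fun p : Ω × T =>
      ENNReal.ofReal (‖f₀ - EWA.op (P p.2) (f₀ + W p.1)‖ ^ 2) :=
    ((hFm.const_sub f₀).norm.pow_const 2).ennreal_ofReal
  have hewam : Measurable fun ω => EWA.ewa σ2 β P pen prior (f₀ + W ω) := by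
    refine (EWA.stronglyMeasurable_integral_tilted (G := fun ω t => EWA.op (P t) (f₀ + W ω))
      ?_ hFm.stronglyMeasurable).measurable
    have ht : Measurable fun p : Ω × T => (P p.2).trace :=
      (EWA.measurable_trace hPm).comp measurable_snd
    have hy : Measurable fun p : Ω × T => f₀ + W p.1 := (hWm.comp measurable_fst).const_add f₀
    have hp : Measurable fun p : Ω × T => pen p.2 := hpenm.comp measurable_snd
    simp only [Function.uncurry_def, EWA.steinRisk]
    exact (((((hy.sub hFm).norm.pow_const 2).add (ht.const_mul _)).sub_const _).add hp).const_mul _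
  have hEm : Measurable fun ω =>
      EWA.evidence σ2 V β δ (EWA.tildeNorm P f₀) P pen prior f₀ (W ω) :=
    (EWA.measurable_evidence hPm hpenm prior f₀).comp hWm
  have hE1 := EWA.lintegral_evidence_le_one hWm hσ hW hPm hP hV hPV prior hβ hpenm hδ hβδ f₀ hpen
  refine ⟨⟨fun y => ?_, hewam⟩, fun η hη => ?_, ?_⟩
  · have hF : StronglyMeasurable fun t => EWA.op (P t) y :=
      (EWA.measurable_op_apply hPm measurable_id measurable_const).stronglyMeasurable
    -- the weights depend on the observation only, so the signal may be taken to be zero here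
    have hℓ : Measurable (EWA.steinNoise σ2 P 0 y) :=
      EWA.measurable_steinNoise hPm 0 measurable_id measurable_const
    have hint := EWA.integrable_exp_gibbsExponent (π := prior) (f₀ := 0) hβ0
      (by simpa using hF) hℓ (EWA.abs_steinNoise_le hσ hP hPV 0 y) hpenm hpen0
      (F := fun t => EWA.op (P t) (0 + y))
    have hprob : IsProbabilityMeasure (EWA.gibbs σ2 β P pen prior y) := by
      rw [← zero_add y, EWA.gibbs_eq_tilted]
      exact isProbabilityMeasure_tilted hint
    exact ⟨hprob, Integrable.of_bound hF.aestronglyMeasurable (V * ‖y‖)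
      (ae_of_all _ fun t => (EWA.op (P t)).le_of_opNorm_le (hPV t) y)⟩
  · obtain ⟨hη0, hη1⟩ := hη
    refine ⟨{ω | EWA.evidence σ2 V β δ (EWA.tildeNorm P f₀) P pen prior f₀ (W ω) ≤
      ENNReal.ofReal (1 / η)}, measurableSet_le hEm measurable_const, ?_, fun ω hω => ?_⟩
    · have hη' : ENNReal.ofReal (1 / η) ≠ 0 := (ENNReal.ofReal_pos.mpr (by positivity)).ne'
      have hM := meas_ge_le_lintegral_div hEm.aemeasurable hη' ENNReal.ofReal_ne_top (μ := Pr)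
      have hc : Pr {ω | EWA.evidence σ2 V β δ (EWA.tildeNorm P f₀) P pen prior f₀ (W ω) ≤
          ENNReal.ofReal (1 / η)}ᶜ ≤ ENNReal.ofReal η := by
        refine (measure_mono fun ω hω => ?_).trans (hM.trans ?_)
        · exact le_of_lt (a := ENNReal.ofReal (1 / η)) (by simpa using hω)
        · rw [one_div, ENNReal.ofReal_inv_of_pos hη0, ENNReal.div_eq_inv_mul, inv_inv]
          exact (mul_le_mul_right hE1 _).trans (mul_one _).le
      rw [ENNReal.ofReal_sub _ hη0.le, ENNReal.ofReal_one, tsub_le_iff_right,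
        ← prob_add_prob_compl (μ := Pr) (measurableSet_le hEm measurable_const)]
      gcongr
    · refine le_iInf₂ fun ν hν => le_iInf fun μ => ?_
      have hlog : 0 ≤ Real.log (1 / η) := Real.log_nonneg (by rw [le_div_iff₀ hη0]; linarith)
      have := EWA.oracle_of_evidence_le hσ hPm hP hV hPV hβ hpenm hδ hβδ hpen (by positivity) hlog
        le_rfl hω (add_zero _).le hν μ
      simpa using this
  · refine le_iInf₂ fun ν hν => le_iInf fun μ => ?_
    set γ := EWA.gam σ2 V β δ with hγ
    have hb' : 0 < β * (1 + EWA.eps' γ ν) := mul_pos hβ0 (EWA.one_add_eps'_pos hν)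
    set b := ENNReal.ofReal (β * (1 + EWA.eps' γ ν)) with hb
    -- `log Z ≤ Z - 1`; both sides are kept nonnegative by moving the constant to the left
    have hpt : ∀ ω, ENNReal.ofReal (‖f₀ - EWA.ewa σ2 β P pen prior (f₀ + W ω)‖ ^ 2) + b ≤
        ENNReal.ofReal (1 + EWA.eps γ ν) *
          ∫⁻ t, ENNReal.ofReal (‖f₀ - EWA.op (P t) (f₀ + W ω)‖ ^ 2) ∂(μ : Measure T)
        + (ENNReal.ofReal (1 + EWA.eps' γ ν) *
            ∫⁻ t, ENNReal.ofReal (pen t + EWA.price σ2 V β δ (EWA.tildeNorm P f₀) (P t))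
              ∂(μ : Measure T)
          + b * (2 * InformationTheory.klDiv (μ : Measure T) prior))
        + b * EWA.evidence σ2 V β δ (EWA.tildeNorm P f₀) P pen prior f₀ (W ω) := by
      intro ω
      by_cases htop : EWA.evidence σ2 V β δ (EWA.tildeNorm P f₀) P pen prior f₀ (W ω) = ∞
      · rw [htop, ENNReal.mul_top (ENNReal.ofReal_pos.mpr hb').ne', add_top]
        exact le_top
      have hpos := ENNReal.toReal_pos (EWA.evidence_pos (σ2 := σ2) (V := V) (β := β) (δ := δ)
        (C := EWA.tildeNorm P f₀) hPm hpenm prior f₀ (W ω)).ne' htop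
      have := EWA.oracle_of_evidence_le hσ hPm hP hV hPV hβ hpenm hδ hβδ hpen hpos.le hpos.le
        zero_le_one (ENNReal.ofReal_toReal htop).ge
        (by linarith [Real.log_le_sub_one_of_pos hpos]) hν μ
      rw [ENNReal.ofReal_toReal htop, ENNReal.ofReal_one, mul_one, ← hγ, ← hb, mul_add b,
        ← add_assoc] at this
      refine this.trans (le_of_eq ?_)
      rw [add_assoc (ENNReal.ofReal _ * _)]
    have hRm' : Measurable fun ω =>
        ∫⁻ t, ENNReal.ofReal (‖f₀ - EWA.op (P t) (f₀ + W ω)‖ ^ 2) ∂(μ : Measure T) :=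
      hRm.lintegral_prod_right'
    have hbt : b ≠ ∞ := ENNReal.ofReal_ne_top
    refine ENNReal.le_of_add_le_add_right hbt ?_
    have hsplit : ENNReal.ofReal (2 * β * (1 + EWA.eps' γ ν)) = b * 2 := by
      rw [hb, mul_assoc, mul_comm (2 : ℝ), ENNReal.ofReal_mul hb'.le]; simp
    calc _ = ∫⁻ ω, (ENNReal.ofReal (‖f₀ - EWA.ewa σ2 β P pen prior (f₀ + W ω)‖ ^ 2) + b) ∂Pr := by
          rw [lintegral_add_right _ measurable_const]; simp
      _ ≤ _ := lintegral_mono hpt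
      _ = _ := by
          rw [lintegral_add_right _ (hEm.const_mul _), lintegral_add_right _ measurable_const,
            lintegral_const_mul _ hRm', lintegral_const_mul _ hEm, lintegral_const]
      _ ≤ _ := by
          rw [measure_univ, mul_one, lintegral_lintegral_swap hRm.aemeasurable, hsplit, mul_assoc,
            ← add_assoc]
          gcongr
          exact (mul_le_mul_right hE1 _).trans (mul_one _).le
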